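/- Let $S$ be a locally noetherian scheme, let $p\colon S'\to S$ be a finite locally free morphism, and let $f\colon X\to S'$ be a smooth quasi-projective morphism. Let $d\in\mathbb Z$ and let $\alpha\colon U\to X$ be a $d$-birational open immersion; that is, $\alpha$ is an open immersion whose image contains every point $x\in X$ with $\dim\mathcal O_{X,x}\le d$. Regard $U$ as an $S'$-scheme via $f\circ\alpha$, and for an $S'$-scheme $Y$ let $R_p(Y)$ denote its Weil restriction, i.e. the $S$-scheme (if it exists) representing the functor $T\mapsto \mathrm{Hom}_{S'}(T\times_S S',Y)$ on $S$-schemes. Then the Weil restrictions $R_p(U)$ and $R_p(X)$ exist, and the induced morphism $R_p(\alpha)\colon R_p(U)\to R_p(X)$ is a $d$-birational open immersion. Here quasi-projective means: $f$ is quasi-compact and, for every affine open $\operatorname{Spec}R\subset S'$, the $R$-scheme $X\times_{S'}\operatorname{Spec}R$ admits an immersion over $R$ into $\mathbb P^n_R$ for some $n$ (every morphism that is quasi-projective in the sense of EGA or of Hartshorne has this property). -/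

import Mathlib

open CategoryTheory Limits Opposite AlgebraicGeometry

universe u

noncomputable section

attribute [local instance] MvPolynomial.gradedAlgebra

/-- Projective space `ℙⁿ_R = Proj R[x₀, …, xₙ]`. -/
def projSpace (n : ℕ) (R : CommRingCat.{u}) : Scheme.{u} :=
  Proj (MvPolynomial.homogeneousSubmodule (Fin (n + 1)) R)

/-- The structure morphism `ℙⁿ_R ⟶ Spec R`: the canonical morphism from `Proj` to the spectrum of
the degree zero part, followed by the morphism induced by `R → R[x₀, …, xₙ]₀`. -/
def projSpaceToSpec (n : ℕ) (R : CommRingCat.{u}) : projSpace n R ⟶ Spec R :=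
  Proj.toSpecZero (MvPolynomial.homogeneousSubmodule (Fin (n + 1)) R) ≫
    Spec.map (CommRingCat.ofHom
      (algebraMap R (MvPolynomial.homogeneousSubmodule (Fin (n + 1)) R 0)))

/-- A morphism `f : X ⟶ Y` is quasi-projective if it is quasi-compact and, over every affine open
`Spec R` of `Y`, its restriction factors as an immersion (isomorphism onto a locally closed
subscheme) into some projective space `ℙⁿ_R` followed by `ℙⁿ_R ⟶ Spec R`. The integer `n` may
depend on the affine open. Over an affine base this is the usual notion. Over an arbitrary base it
is implied both by the existence of a quasi-compact immersion into a projective space over `Y`, and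
by `f` being of finite type with an `f`-ample invertible sheaf on `X`. -/
structure IsQuasiProjective {X Y : Scheme.{u}} (f : X ⟶ Y) : Prop where
  quasiCompact : QuasiCompact f
  exists_immersion : ∀ (R : CommRingCat.{u}) (i : Spec R ⟶ Y), IsOpenImmersion i →
    ∃ (n : ℕ) (j : pullback f i ⟶ projSpace n R),
      IsImmersion j ∧ j ≫ projSpaceToSpec n R = pullback.snd f i

/-- `f : U ⟶ X` is a `d`-birational open immersion: it is an open immersion whose image contains
every point `x` of `X` of codimension `dim 𝒪_{X,x}` at most `d`. -/
structure IsDBirational (d : ℤ) {U X : Scheme.{u}} (f : U ⟶ X) : Prop where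
  isOpenImmersion : IsOpenImmersion f
  mem_range : ∀ (x : X) (n : ℕ), ringKrullDim (X.presheaf.stalk x) = n → (n : ℤ) ≤ d →
    x ∈ Set.range f

/-- The Weil restriction along `p : S' ⟶ S` of an `S'`-scheme `X`, as a presheaf on `S`-schemes:
it sends `T` to the set of `S'`-morphisms `T ×_S S' ⟶ X`. -/
def weilRestriction {S' S : Scheme.{u}} (p : S' ⟶ S) (X : Over S') : (Over S)ᵒᵖ ⥤ Type u :=
  (Over.pullback p).op ⋙ yoneda.obj X

/-- The morphism of Weil restrictions induced by `α : U ⟶ X`: on `T`-valued points it is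
composition with `α`. -/
def weilRestrictionMap {S' S : Scheme.{u}} (p : S' ⟶ S) {U X : Over S'} (α : U ⟶ X) :
    weilRestriction p U ⟶ weilRestriction p X :=
  Functor.whiskerLeft (Over.pullback p).op (yoneda.map α)

/-- The morphism of `S`-schemes `R_p(U) ⟶ R_p(X)` induced by `α : U ⟶ X`, for `S`-schemes `RU` and
`RX` representing the Weil restrictions of `U` and `X`. -/
def weilRestrictionHom {S' S : Scheme.{u}} {p : S' ⟶ S} {U X : Over S'} (α : U ⟶ X)
    {RU RX : Over S} (hU : (weilRestriction p U).RepresentableBy RU)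
    (hX : (weilRestriction p X).RepresentableBy RX) : RU ⟶ RX :=
  hX.homEquiv.symm ((weilRestrictionMap p α).app (op RU) (hU.homEquiv (𝟙 RU)))

end

/-! The proof rests on the evaluation morphism `ev : R_p(X) ×_S S' ⟶ X`, the universal point of the
Weil restriction. By the infinitesimal criterion `ev` is formally smooth
(`WeilRestriction.IsUniversal.formallySmooth`), and over a noetherian base it is flat
(`WeilRestriction.IsUniversal.flat`). Let `z` lie over `y ∈ R_p(X)`. Going down along `ev` and
incomparability along the integral projection to `R_p(X)` give `codim (ev z) ≤ codim z ≤ codim y`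
(`ringKrullDim_stalk_ofAlgHom_le`).

Now `R_p(U)` is the open locus of those `y` for which `ev z` lies in `U` for every `z` over `y`; it
is open because finite morphisms are closed. If `y` has codimension at most `d`, so does every such
`ev z`. Hence each `ev z` lies in `U`, and `y` lies in `R_p(U)`
(`WeilPoint.IsUniversal.isDBirational`).

Existence is local. For affine `A ⊆ S` and affine `V ⊆ X` over `A`, the Weil restriction is the
spectrum of an algebra given by generators and relations (`WeilRestriction.exists_isUniversal`). The
resulting charts cover: the fibre of `T ×_S S'` over a point of `T` is finite, and homogeneous prime
avoidance puts finitely many points of a quasi-projective scheme into one affine open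
(`WeilPoint.exists_mem_chartLocus`). Charts are relatively represented by open immersions, so the
Zariski sheaf of points is representable (`WeilPoint.exists_isUniversal_of_charts`). -/

open TensorProduct

namespace WeilRestriction

/-! ### Coordinates on `R' ⊗ B` for a finite projective `R`-algebra `R'`. -/

section Coordinates

variable {R R' : Type*} [CommRing R] [CommRing R'] [Algebra R R']

/-- The base change of a linear form on `R'` to a `B`-valued form on `R' ⊗ B`. -/
noncomputable def baseChangeForm (l : R' →ₗ[R] R) (B : Type*) [CommRing B] [Algebra R B] :
    R' ⊗[R] B →ₗ[R] B :=
  (TensorProduct.lid R B).toLinearMap ∘ₗ LinearMap.rTensor B l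

@[simp]
lemma baseChangeForm_tmul (l : R' →ₗ[R] R) {B : Type*} [CommRing B] [Algebra R B]
    (r : R') (b : B) : baseChangeForm l B (r ⊗ₜ b) = l r • b := by
  simp [baseChangeForm]

variable (R') in
/-- The base change `R' ⊗ B → R' ⊗ B'` of an `R`-algebra homomorphism. -/
noncomputable def baseChangeHom {B B' : Type*} [CommRing B] [Algebra R B]
    [CommRing B'] [Algebra R B'] (θ : B →ₐ[R] B') : R' ⊗[R] B →ₐ[R'] R' ⊗[R] B' :=
  Algebra.TensorProduct.map (AlgHom.id R' R') θ

section

variable {B B' B'' : Type*} [CommRing B] [Algebra R B]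
    [CommRing B'] [Algebra R B'] [CommRing B''] [Algebra R B'']

@[simp]
lemma baseChangeHom_tmul (θ : B →ₐ[R] B') (r : R') (b : B) :
    baseChangeHom R' θ (r ⊗ₜ b) = r ⊗ₜ θ b := rfl

lemma baseChangeHom_comp (θ : B →ₐ[R] B') (θ' : B' →ₐ[R] B'') :
    baseChangeHom R' (θ'.comp θ) = (baseChangeHom R' θ').comp (baseChangeHom R' θ) := by
  ext; rfl

lemma baseChangeHom_baseChangeHom (θ : B →ₐ[R] B') (θ' : B' →ₐ[R] B'') (z : R' ⊗[R] B) :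
    baseChangeHom R' θ' (baseChangeHom R' θ z) = baseChangeHom R' (θ'.comp θ) z := by
  rw [baseChangeHom_comp, AlgHom.comp_apply]

@[simp]
lemma baseChangeHom_id : baseChangeHom R' (AlgHom.id R B) = AlgHom.id R' (R' ⊗[R] B) := by
  ext; rfl

lemma baseChangeForm_map (l : R' →ₗ[R] R) (θ : B →ₐ[R] B') (z : R' ⊗[R] B) :
    baseChangeForm l B' (baseChangeHom R' θ z) = θ (baseChangeForm l B z) := by
  induction z with
  | zero => simp
  | tmul r b => simp
  | add x y hx hy => simp only [map_add, hx, hy]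

end

/-- A finite projective module is a retract of some `Rⁿ`. Using a dual basis instead of a basis
avoids localizing until `R'` is free. -/
lemma exists_dual_basis (R R' : Type*) [CommRing R] [CommRing R'] [Algebra R R']
    [Module.Finite R R'] [Module.Projective R R'] :
    ∃ (n : ℕ) (e : Fin n → R') (l : Fin n → R' →ₗ[R] R), ∀ r, ∑ i, l i r • e i = r := by
  obtain ⟨n, f, g, -, -, h⟩ := Module.Finite.exists_comp_eq_id_of_projective R R'
  refine ⟨n, fun i ↦ f (Pi.single i 1), fun i ↦ LinearMap.proj i ∘ₗ g, fun r ↦ ?_⟩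
  have h1 : f (g r) = r := LinearMap.congr_fun h r
  conv_rhs => rw [← h1, pi_eq_sum_univ' (g r), map_sum]
  refine Finset.sum_congr rfl fun i _ ↦ ?_
  simp only [LinearMap.comp_apply, LinearMap.proj_apply, map_smul]

variable {n : ℕ} {e : Fin n → R'} {l : Fin n → R' →ₗ[R] R}

/-- The dual basis survives base change. The coordinates determine `z`, but since the `e i` may be
dependent, not every tuple need be a tuple of coordinates. -/
lemma sum_tmul_baseChangeForm (hel : ∀ r, ∑ i, l i r • e i = r)
    {B : Type*} [CommRing B] [Algebra R B] (z : R' ⊗[R] B) :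
    ∑ i, e i ⊗ₜ[R] baseChangeForm (l i) B z = z := by
  induction z with
  | zero => simp
  | tmul r b =>
    simp only [baseChangeForm_tmul, TensorProduct.tmul_smul, TensorProduct.smul_tmul']
    rw [← TensorProduct.sum_tmul, hel]
  | add x y hx hy =>
    conv_rhs => rw [← hx, ← hy]
    simp only [map_add, TensorProduct.tmul_add, Finset.sum_add_distrib]

lemma ext_baseChangeForm (hel : ∀ r, ∑ i, l i r • e i = r)
    {B : Type*} [CommRing B] [Algebra R B] {z z' : R' ⊗[R] B}
    (h : ∀ i, baseChangeForm (l i) B z = baseChangeForm (l i) B z') : z = z' := by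
  rw [← sum_tmul_baseChangeForm hel z, ← sum_tmul_baseChangeForm hel z']
  simp only [h]

end Coordinates

/-! ### Weil restriction of algebras, and smoothness of the universal homomorphism. -/

variable {R R' C W : Type u} [CommRing R] [CommRing R'] [CommRing C] [CommRing W]
  [Algebra R R'] [Algebra R' C] [Algebra R W]

/-- `φ : C → R' ⊗ W` exhibits the `R`-algebra `W` as the Weil restriction of the
`R'`-algebra `C`. -/
def IsUniversal (φ : C →ₐ[R'] R' ⊗[R] W) : Prop :=
  ∀ (B : Type u) [CommRing B] [Algebra R B] (ψ : C →ₐ[R'] R' ⊗[R] B),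
    ∃! θ : W →ₐ[R] B, (baseChangeHom R' θ).comp φ = ψ

lemma IsUniversal.hom_ext {φ : C →ₐ[R'] R' ⊗[R] W} (hφ : IsUniversal φ) {B : Type u} [CommRing B]
    [Algebra R B] {θ θ' : W →ₐ[R] B}
    (h : (baseChangeHom R' θ).comp φ =
      (baseChangeHom R' θ').comp φ) : θ = θ' :=
  (hφ B _).unique h rfl

variable (R R' C) in
/-- Weil restriction of algebras along a finite projective extension exists. -/
theorem exists_isUniversal [Module.Finite R R'] [Module.Projective R R'] :
    ∃ (W : Type u) (_ : CommRing W) (_ : Algebra R W) (φ : C →ₐ[R'] R' ⊗[R] W),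
      IsUniversal φ := by
  obtain ⟨n, e, l, hel⟩ := exists_dual_basis R R'
  -- The variable `X (c, i)` stands for the `i`-th coordinate of the image of `c`.
  let P := MvPolynomial (C × Fin n) R
  let φ₀ : C → R' ⊗[R] P := fun c ↦ ∑ i, e i ⊗ₜ MvPolynomial.X (c, i)
  let rel : Set (R' ⊗[R] P) :=
    {z | (∃ c c', z = φ₀ (c + c') - (φ₀ c + φ₀ c')) ∨ (∃ c c', z = φ₀ (c * c') - φ₀ c * φ₀ c') ∨
      ∃ r, z = φ₀ (algebraMap R' C r) - algebraMap R' _ r}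
  -- The first family makes `φ₀` an `R'`-algebra homomorphism. The second makes the variables the
  -- actual coordinates of `φ₀ c`; as the `e i` need not be a basis, this is not automatic, and
  -- uniqueness depends on it.
  let I : Ideal P := Ideal.span
    ({x | ∃ z ∈ rel, ∃ k, x = baseChangeForm (l k) P z} ∪
      {x | ∃ c k, x = baseChangeForm (l k) P (φ₀ c) - MvPolynomial.X (c, k)})
  let mk : P →ₐ[R] P ⧸ I := Ideal.Quotient.mkₐ R I
  let m := baseChangeHom R' mk
  have hrel : ∀ z ∈ rel, m z = 0 := by
    intro z hz
    refine ext_baseChangeForm hel fun k ↦ ?_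
    rw [baseChangeForm_map, map_zero]
    exact Ideal.Quotient.eq_zero_iff_mem.mpr (Ideal.subset_span (Or.inl ⟨z, hz, k, rfl⟩))
  have hX (c : C) (k) : mk (MvPolynomial.X (c, k)) = baseChangeForm (l k) (P ⧸ I) (m (φ₀ c)) := by
    rw [baseChangeForm_map]
    symm
    rw [← sub_eq_zero, ← map_sub]
    exact Ideal.Quotient.eq_zero_iff_mem.mpr (Ideal.subset_span (Or.inr ⟨c, k, rfl⟩))
  have hadd (c c') : m (φ₀ (c + c')) = m (φ₀ c) + m (φ₀ c') := by
    rw [← sub_eq_zero, ← map_add, ← map_sub]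
    exact hrel _ (Or.inl ⟨c, c', rfl⟩)
  have hmul (c c') : m (φ₀ (c * c')) = m (φ₀ c) * m (φ₀ c') := by
    rw [← sub_eq_zero, ← map_mul, ← map_sub]
    exact hrel _ (Or.inr (Or.inl ⟨c, c', rfl⟩))
  have halg (r) : m (φ₀ (algebraMap R' C r)) = algebraMap R' _ r := by
    rw [← AlgHom.commutes m, ← sub_eq_zero, ← map_sub]
    exact hrel _ (Or.inr (Or.inr ⟨r, rfl⟩))
  let φ : C →ₐ[R'] R' ⊗[R] (P ⧸ I) :=
    { toFun c := m (φ₀ c)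
      map_one' := by rw [← map_one (algebraMap R' C), halg, map_one]
      map_mul' := hmul
      map_zero' := by simpa using halg 0
      map_add' := hadd
      commutes' := halg }
  refine ⟨P ⧸ I, inferInstance, inferInstance, φ, fun B _ _ ψ ↦ ?_⟩
  obtain ⟨ev, hevX⟩ : ∃ ev : P →ₐ[R] B, ∀ c k,
      ev (MvPolynomial.X (c, k)) = baseChangeForm (l k) B (ψ c) :=
    ⟨MvPolynomial.aeval fun x ↦ baseChangeForm (l x.2) B (ψ x.1),
      fun c k ↦ MvPolynomial.aeval_X _ _⟩
  have hev (c : C) : baseChangeHom R' ev (φ₀ c) = ψ c := by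
    conv_rhs => rw [← sum_tmul_baseChangeForm hel (ψ c)]
    simp only [φ₀, map_sum, baseChangeHom_tmul, hevX]
  have hev_rel : ∀ z ∈ rel, baseChangeHom R' ev z = 0 := by
    rintro z (⟨c, c', rfl⟩ | ⟨c, c', rfl⟩ | ⟨r, rfl⟩)
    · rw [map_sub, map_add, hev, hev, hev, map_add, sub_self]
    · rw [map_sub, map_mul, hev, hev, hev, map_mul, sub_self]
    · rw [map_sub, hev, AlgHom.commutes, AlgHom.commutes, sub_self]
  have hI : I ≤ RingHom.ker ev := by
    refine Ideal.span_le.mpr ?_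
    rintro x (⟨z, hz, k, rfl⟩ | ⟨c, k, rfl⟩)
    · change ev _ = 0
      rw [← baseChangeForm_map, hev_rel z hz, map_zero]
    · change ev _ = 0
      rw [map_sub, ← baseChangeForm_map, hev, hevX, sub_self]
  obtain ⟨θ₀, hθ₀⟩ : ∃ θ₀ : P ⧸ I →ₐ[R] B, θ₀.comp mk = ev :=
    ⟨Ideal.Quotient.liftₐ I ev hI, Ideal.Quotient.liftₐ_comp _ _ _⟩
  refine ⟨θ₀, ?_, fun θ hθ ↦ ?_⟩
  · refine AlgHom.ext fun c ↦ ?_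
    change baseChangeHom R' θ₀ (baseChangeHom R' mk (φ₀ c)) = _
    rw [baseChangeHom_baseChangeHom, hθ₀, hev]
  · apply Ideal.Quotient.algHom_ext
    change θ.comp mk = θ₀.comp mk
    rw [hθ₀]
    refine MvPolynomial.algHom_ext fun ⟨c, k⟩ ↦ ?_
    change θ (mk (MvPolynomial.X (c, k))) = _
    rw [hX, ← baseChangeForm_map, hevX, ← hθ]
    rfl

/-- Let `W₀` be generated by the coordinates of the images of generators of `C`. Flatness of `R'`
embeds `R' ⊗ W₀` in `R' ⊗ W`, and `φ` lands in it. Universality then yields `W → W₀` whose composite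
with the inclusion is the identity, so `W₀` is everything. -/
theorem IsUniversal.finiteType [Module.Finite R R'] [Module.Projective R R']
    {φ : C →ₐ[R'] R' ⊗[R] W} (hφ : IsUniversal φ) [Algebra.FiniteType R' C] :
    Algebra.FiniteType R W := by
  classical
  obtain ⟨n, e, l, hel⟩ := exists_dual_basis R R'
  obtain ⟨s, hs⟩ := Algebra.FiniteType.out (R := R') (A := C)
  let t : Finset W := (s ×ˢ Finset.univ).image fun x ↦ baseChangeForm (l x.2) W (φ x.1)
  let W₀ := Algebra.adjoin R (t : Set W)
  let ι : R' ⊗[R] W₀ →ₐ[R'] R' ⊗[R] W := baseChangeHom R' W₀.val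
  have hι : Function.Injective ι :=
    Module.Flat.lTensor_preserves_injective_linearMap (M := R') W₀.val.toLinearMap
      Subtype.val_injective
  have hrange : φ.range ≤ ι.range := by
    rw [← Algebra.map_top, ← hs, AlgHom.map_adjoin]
    refine Algebra.adjoin_le ?_
    rintro _ ⟨c, hc, rfl⟩
    refine ⟨∑ i, e i ⊗ₜ ⟨baseChangeForm (l i) W (φ c), Algebra.subset_adjoin ?_⟩, ?_⟩
    · exact Finset.mem_image.mpr ⟨(c, i), by simpa using hc, rfl⟩
    · conv_rhs => rw [← sum_tmul_baseChangeForm hel (φ c)]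
      simp [ι]
  let ψ : C →ₐ[R'] R' ⊗[R] W₀ :=
    (AlgEquiv.ofInjective ι hι).symm.toAlgHom.comp
      ((Subalgebra.inclusion hrange).comp φ.rangeRestrict)
  have hψ : ι.comp ψ = φ := by
    ext c
    have := congr_arg Subtype.val ((AlgEquiv.ofInjective ι hι).apply_symm_apply
      (Subalgebra.inclusion hrange (φ.rangeRestrict c)))
    exact this
  obtain ⟨θ, hθ, -⟩ := hφ W₀ ψ
  have hid : W₀.val.comp θ = AlgHom.id R W := by
    apply hφ.hom_ext
    rw [baseChangeHom_id, baseChangeHom_comp, AlgHom.comp_assoc, hθ, AlgHom.id_comp]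
    exact hψ
  refine ⟨t, eq_top_iff.mpr fun w _ ↦ ?_⟩
  have := AlgHom.congr_fun hid w
  simp only [AlgHom.comp_apply, AlgHom.id_apply] at this
  rw [← this]
  exact (θ w).2

/-- Lifting along `B → B₀ ×_{D₀} D`, where `B → B₀` is a square zero extension and
`ker (B → B₀) → ker (D → D₀)` is surjective. -/
lemma exists_lift_fiberProduct {k A B B₀ D D₀ : Type*} [CommRing k] [CommRing A] [CommRing B]
    [CommRing B₀] [CommRing D] [CommRing D₀] [Algebra k A] [Algebra k B] [Algebra k B₀]
    [Algebra k D] [Algebra k D₀] [Algebra.FormallySmooth k A]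
    (p : B →ₐ[k] B₀) (μ : B →ₐ[k] D) (q : D →ₐ[k] D₀) (μ₀ : B₀ →ₐ[k] D₀)
    (hpq : ∀ b, μ₀ (p b) = q (μ b)) (hp : Function.Surjective p)
    (hker : RingHom.ker p ^ 2 = ⊥) (hμ : ∀ a, q a = 0 → ∃ b, p b = 0 ∧ μ b = a)
    (ψ₀ : A →ₐ[k] B₀) (s : A →ₐ[k] D) (hs : ∀ a, μ₀ (ψ₀ a) = q (s a)) :
    ∃ ψ : A →ₐ[k] B, (∀ a, p (ψ a) = ψ₀ a) ∧ ∀ a, μ (ψ a) = s a := by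
  let E : Subalgebra k (B₀ × D) :=
    AlgHom.equalizer (μ₀.comp (AlgHom.fst k B₀ D)) (q.comp (AlgHom.snd k B₀ D))
  let π : B →ₐ[k] E := (p.prod μ).codRestrict E hpq
  let σ : A →ₐ[k] E := (ψ₀.prod s).codRestrict E hs
  have hπ : Function.Surjective π := by
    rintro ⟨⟨x, d⟩, hxd⟩
    replace hxd : μ₀ x = q d := hxd
    obtain ⟨y, rfl⟩ := hp x
    -- A lift `y` of the first component is corrected inside `ker p` to get the second component
    -- right.
    obtain ⟨b, hb, hb'⟩ := hμ (μ y - d) (by rw [map_sub, ← hpq, hxd, sub_self])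
    refine ⟨y - b, Subtype.ext (Prod.ext ?_ ?_)⟩
    · change p (y - b) = p y
      rw [map_sub, hb, sub_zero]
    · change μ (y - b) = d
      rw [map_sub, hb', sub_sub_cancel]
  have hπker : IsNilpotent (RingHom.ker (π : B →+* E)) := by
    refine ⟨2, ?_⟩
    rw [Ideal.zero_eq_bot, eq_bot_iff, ← hker]
    exact Ideal.pow_right_mono (fun x hx ↦ congr_arg (fun z : E ↦ z.1.1) hx) 2
  have h (a) := Algebra.FormallySmooth.liftOfSurjective_apply σ π hπ hπker a
  exact ⟨Algebra.FormallySmooth.liftOfSurjective σ π hπ hπker,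
    fun a ↦ congr_arg (fun z : E ↦ z.1.1) (h a), fun a ↦ congr_arg (fun z : E ↦ z.1.2) (h a)⟩

/-- An `R'`-map `R' ⊗ W → D` is an `R`-map `W → D`, hence an `R'`-map `C → R' ⊗ D`; its restriction
along `φ` is recovered by composing with the multiplication `μ : R' ⊗ D → D`. So the task is to lift
`C → R' ⊗ D₀` to `R' ⊗ D` with prescribed composite with `μ`, a lifting problem over a fibre
product. -/
lemma IsUniversal.exists_lift {φ : C →ₐ[R'] R' ⊗[R] W} (hφ : IsUniversal φ)
    [Algebra.FormallySmooth R' C] {D D₀ : Type u} [CommRing D] [CommRing D₀] [Algebra R D]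
    [Algebra R' D] [IsScalarTower R R' D] [Algebra R D₀] [Algebra R' D₀] [IsScalarTower R R' D₀]
    (q : D →ₐ[R'] D₀) (hq : Function.Surjective q) (hker : RingHom.ker q ^ 2 = ⊥)
    (s : C →ₐ[R'] D) (g : R' ⊗[R] W →ₐ[R'] D₀) (hg : ∀ c, g (φ c) = q (s c)) :
    ∃ G : R' ⊗[R] W →ₐ[R'] D, (∀ c, G (φ c) = s c) ∧ ∀ x, q (G x) = g x := by
  let θ₀ : W →ₐ[R] D₀ := (g.restrictScalars R).comp Algebra.TensorProduct.includeRight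
  let q' : D →ₐ[R] D₀ := q.restrictScalars R
  let μ : R' ⊗[R] D →ₐ[R'] D :=
    Algebra.TensorProduct.lift (Algebra.ofId R' D) (AlgHom.id R D) fun _ _ ↦ .all _ _
  let μ₀ : R' ⊗[R] D₀ →ₐ[R'] D₀ :=
    Algebra.TensorProduct.lift (Algebra.ofId R' _) (AlgHom.id R _) fun _ _ ↦ .all _ _
  have hμ : μ₀.comp (baseChangeHom R' q') = q.comp μ := by
    ext x
    simp [μ, μ₀, q']
  have hμ₀ : μ₀.comp (baseChangeHom R' θ₀) = g := by
    ext x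
    simp [μ₀, θ₀]
  have hsurj : Function.Surjective (baseChangeHom R' q') :=
    Algebra.TensorProduct.map_surjective _ _ Function.surjective_id hq
  have hker' : RingHom.ker (baseChangeHom R' q') =
      (RingHom.ker q').map (Algebra.TensorProduct.includeRight : D →ₐ[R] R' ⊗[R] D) :=
    Algebra.TensorProduct.lTensor_ker (A := R') q' hq
  obtain ⟨ψ, hψ, hψ'⟩ := exists_lift_fiberProduct (baseChangeHom R' q') μ q μ₀
    (AlgHom.congr_fun hμ) hsurj
    (by
      rw [hker', ← Ideal.map_pow, show RingHom.ker q' ^ 2 = ⊥ from hker, Ideal.map_bot])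
    (fun a ha ↦ ⟨1 ⊗ₜ a, by
      rw [baseChangeHom_tmul, show q' a = 0 from ha, TensorProduct.tmul_zero], by simp [μ]⟩)
    ((baseChangeHom R' θ₀).comp φ) s
    (fun c ↦ (AlgHom.congr_fun hμ₀ (φ c)).trans (hg c))
  obtain ⟨θ, hθ, -⟩ := hφ D ψ
  have hθ₀ : q'.comp θ = θ₀ := by
    apply hφ.hom_ext
    rw [baseChangeHom_comp, AlgHom.comp_assoc, hθ]
    exact AlgHom.ext hψ
  refine ⟨μ.comp (baseChangeHom R' θ), fun c ↦ ?_, fun x ↦ ?_⟩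
  · rw [← hψ', ← hθ]
    rfl
  · rw [← hμ₀, ← hθ₀, baseChangeHom_comp, ← AlgHom.comp_assoc, hμ]
    rfl

theorem IsUniversal.formallySmooth {φ : C →ₐ[R'] R' ⊗[R] W} (hφ : IsUniversal φ)
    [Algebra.FormallySmooth R' C] : φ.toRingHom.FormallySmooth := by
  let : Algebra C (R' ⊗[R] W) := φ.toRingHom.toAlgebra
  change Algebra.FormallySmooth C (R' ⊗[R] W)
  refine Algebra.FormallySmooth.of_comp_surjective fun D _ _ I hI g ↦ ?_
  let : Algebra R' D := ((algebraMap C D).comp (algebraMap R' C)).toAlgebra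
  let : Algebra R D := ((algebraMap R' D).comp (algebraMap R R')).toAlgebra
  have : IsScalarTower R' C D := .of_algebraMap_eq fun _ ↦ rfl
  have : IsScalarTower R R' D := .of_algebraMap_eq fun _ ↦ rfl
  have hg (c : C) : g (φ c) = Ideal.Quotient.mk I (algebraMap C D c) := g.commutes c
  let g' : R' ⊗[R] W →ₐ[R'] D ⧸ I :=
    AlgHom.mk' g.toRingHom fun r x ↦ by
      change g (r • x) = r • g x
      rw [Algebra.smul_def, map_mul, Algebra.smul_def, ← AlgHom.commutes φ, hg]
      rfl
  obtain ⟨G, hG, hG'⟩ := hφ.exists_lift (Ideal.Quotient.mkₐ R' I) Ideal.Quotient.mk_surjective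
    (by rw [← hI]; exact congr_arg (· ^ 2) (Ideal.Quotient.mkₐ_ker R' I))
    (IsScalarTower.toAlgHom R' C D) g' hg
  exact ⟨{ G.toRingHom with commutes' := hG }, AlgHom.ext hG'⟩

/-- The noetherian hypothesis upgrades finite type to finite presentation, so that formal smoothness
of `φ` becomes smoothness. -/
theorem IsUniversal.flat [IsNoetherianRing R] [Module.Finite R R'] [Module.Projective R R']
    {φ : C →ₐ[R'] R' ⊗[R] W} (hφ : IsUniversal φ) [Algebra.Smooth R' C] :
    φ.toRingHom.Flat := by
  have := hφ.finiteType
  have hs := hφ.formallySmooth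
  have : IsNoetherianRing R' := IsNoetherianRing.of_finite R R'
  have : IsNoetherianRing C := Algebra.FiniteType.isNoetherianRing R' C
  let := φ.toRingHom.toAlgebra
  have : IsScalarTower R' C (R' ⊗[R] W) := .of_algebraMap_eq fun r ↦ (φ.commutes r).symm
  have : Algebra.FormallySmooth C (R' ⊗[R] W) := hs
  have : Algebra.FiniteType C (R' ⊗[R] W) := .of_restrictScalars_finiteType R' _ _
  have : Algebra.FinitePresentation C (R' ⊗[R] W) :=
    Algebra.FinitePresentation.of_finiteType.mp inferInstance
  have : Algebra.Smooth C (R' ⊗[R] W) := { }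
  exact Algebra.Smooth.flat _ _

end WeilRestriction

/-! ### Heights of primes under flat and integral homomorphisms. -/

/-- Going down lifts a chain of primes ending at the contraction to a chain of the same length
ending at `Q`. -/
lemma Ideal.height_comap_le_of_flat {A B : Type*} [CommRing A] [CommRing B] {f : A →+* B}
    (hf : f.Flat) (Q : Ideal B) [Q.IsPrime] : (Q.comap f).height ≤ Q.height := by
  algebraize [f]
  let q : PrimeSpectrum A := ⟨Q.comap f, inferInstance⟩
  let Q' : PrimeSpectrum B := ⟨Q, inferInstance⟩
  change q.asIdeal.height ≤ Q'.asIdeal.height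
  rw [PrimeSpectrum.height_eq_orderHeight, PrimeSpectrum.height_eq_orderHeight]
  refine Order.height_le fun l hl ↦ ?_
  have : Q.LiesOver l.last.asIdeal := ⟨by rw [hl]; rfl⟩
  obtain ⟨L, hL, hlast, -⟩ := Ideal.exists_ltSeries_of_hasGoingDown l Q
  rw [← hL]
  exact Order.length_le_height (p := L) hlast.le

/-- Incomparability: contraction along an integral homomorphism preserves strict inclusions of
primes. -/
lemma Ideal.height_le_height_comap_of_isIntegral {A B : Type*} [CommRing A] [CommRing B]
    {f : A →+* B} (hf : f.IsIntegral) (Q : Ideal B) [Q.IsPrime] :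
    Q.height ≤ (Q.comap f).height := by
  algebraize [f]
  let q : PrimeSpectrum A := ⟨Q.comap f, inferInstance⟩
  let Q' : PrimeSpectrum B := ⟨Q, inferInstance⟩
  change Q'.asIdeal.height ≤ q.asIdeal.height
  rw [PrimeSpectrum.height_eq_orderHeight, PrimeSpectrum.height_eq_orderHeight]
  exact Order.height_le_height_apply_of_strictMono (PrimeSpectrum.comap f)
    (fun P P' h ↦ by
      obtain ⟨x, hx, hx'⟩ := Set.exists_of_ssubset (show P.asIdeal < P'.asIdeal from h)
      exact Ideal.comap_lt_comap_of_integral_mem_sdiff (x := x) h.le ⟨hx, hx'⟩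
        (Algebra.IsIntegral.isIntegral x)) Q'

/-! ### Homogeneous prime avoidance and finite sets of points in projective space. -/

section ProjPrimeAvoidance

variable {σ A : Type*} [CommRing A] [SetLike σ A] [AddSubmonoidClass σ A] {𝒜 : ℕ → σ}
  [GradedRing 𝒜]

lemma Ideal.exists_decompose_notMem {I : Ideal A} {a : A}
    (ha : a ∉ I) : ∃ i, ((DirectSum.decompose 𝒜 a i : 𝒜 i) : A) ∉ I := by
  classical
  by_contra! h
  refine ha ?_
  rw [← DirectSum.sum_support_decompose 𝒜 a]
  exact Ideal.sum_mem _ fun i _ ↦ h i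

namespace ProjectiveSpectrum

lemma exists_homogeneous_pos_notMem (x : ProjectiveSpectrum 𝒜) :
    ∃ m > 0, ∃ a ∈ 𝒜 m, a ∉ x.asHomogeneousIdeal := by
  obtain ⟨c, hc, hcx⟩ := SetLike.not_le_iff_exists.mp x.not_irrelevant_le
  obtain ⟨i, hi⟩ := Ideal.exists_decompose_notMem (𝒜 := 𝒜)
    (I := x.asHomogeneousIdeal.toIdeal) hcx
  refine ⟨i, Nat.pos_of_ne_zero ?_, _, SetLike.coe_mem _, hi⟩
  rintro rfl
  refine hi ?_
  rw [HomogeneousIdeal.mem_irrelevant_iff, GradedRing.proj_apply] at hc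
  rw [hc]
  exact Ideal.zero_mem _

lemma exists_basicOpen_le {x : ProjectiveSpectrum 𝒜} {O : Set (ProjectiveSpectrum 𝒜)}
    (hO : IsOpen O) (hx : x ∈ O) :
    ∃ m > 0, ∃ a ∈ 𝒜 m, a ∉ x.asHomogeneousIdeal ∧ ∀ w, a ∉ w.asHomogeneousIdeal → w ∈ O := by
  obtain ⟨s, hs⟩ := (isOpen_iff 𝒜 O).mp hO
  have hxs : x ∉ zeroLocus 𝒜 s := by rwa [← hs, Set.notMem_compl_iff]
  obtain ⟨b, hb, hbx⟩ := Set.not_subset.mp hxs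
  obtain ⟨i, hi⟩ := Ideal.exists_decompose_notMem (𝒜 := 𝒜)
    (I := x.asHomogeneousIdeal.toIdeal) hbx
  -- The extra factor makes the total degree positive, as is needed for the standard open to be
  -- affine.
  obtain ⟨m, hm, a, ha, hax⟩ := exists_homogeneous_pos_notMem x
  refine ⟨i + m, by omega, DirectSum.decompose 𝒜 b i * a,
    SetLike.mul_mem_graded (SetLike.coe_mem _) ha, ?_, fun w hw ↦ ?_⟩
  · exact fun h ↦ (x.isPrime.mem_or_mem h).elim hi hax
  · by_contra hwO
    have hws : w ∈ zeroLocus 𝒜 s := by rwa [← hs]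
    exact hw (Ideal.mul_mem_right _ _ (w.asHomogeneousIdeal.isHomogeneous i (hws hb)))

lemma exists_homogeneous_mem_notMem {x y : ProjectiveSpectrum 𝒜} (h : ¬ y ≤ x) :
    ∃ i, ∃ a ∈ 𝒜 i, a ∈ y.asHomogeneousIdeal ∧ a ∉ x.asHomogeneousIdeal := by
  obtain ⟨b, hb, hbx⟩ := SetLike.not_le_iff_exists (p := y.asHomogeneousIdeal) |>.mp h
  obtain ⟨i, hi⟩ := Ideal.exists_decompose_notMem (𝒜 := 𝒜)
    (I := x.asHomogeneousIdeal.toIdeal) hbx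
  exact ⟨i, _, SetLike.coe_mem _, y.asHomogeneousIdeal.isHomogeneous i hb, hi⟩

lemma exists_homogeneous_forall_mem_notMem (x : ProjectiveSpectrum 𝒜)
    (Z : Finset (ProjectiveSpectrum 𝒜)) (hZ : ∀ y ∈ Z, ¬ y ≤ x) :
    ∃ i, ∃ a ∈ 𝒜 i, (∀ y ∈ Z, a ∈ y.asHomogeneousIdeal) ∧ a ∉ x.asHomogeneousIdeal := by
  classical
  induction Z using Finset.induction_on with
  | empty =>
    exact ⟨0, 1, SetLike.one_mem_graded 𝒜, by simp,
      (Ideal.ne_top_iff_one _).mp x.isPrime.ne_top⟩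
  | insert z Z _ ih =>
    obtain ⟨i, a, ha, haZ, hax⟩ := ih fun y hy ↦ hZ y (Finset.mem_insert_of_mem hy)
    obtain ⟨j, b, hb, hbz, hbx⟩ := exists_homogeneous_mem_notMem
      (hZ z (Finset.mem_insert_self _ _))
    refine ⟨i + j, _, SetLike.mul_mem_graded ha hb, fun y hy ↦ ?_,
      fun h ↦ (x.isPrime.mem_or_mem h).elim hax hbx⟩
    rcases Finset.mem_insert.mp hy with rfl | hy
    · exact Ideal.mul_mem_left _ _ hbz
    · exact Ideal.mul_mem_right _ _ (haZ y hy)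

/-- Homogeneous prime avoidance: a finite set of points of `Proj` contained in an open subset is
contained in a standard open contained in this subset. -/
theorem exists_basicOpen_of_finset (Z : Finset (ProjectiveSpectrum 𝒜))
    {O : Set (ProjectiveSpectrum 𝒜)} (hO : IsOpen O) (hZ : ∀ z ∈ Z, z ∈ O) (hne : Z.Nonempty) :
    ∃ m > 0, ∃ a ∈ 𝒜 m, (∀ z ∈ Z, a ∉ z.asHomogeneousIdeal) ∧
      ∀ w, a ∉ w.asHomogeneousIdeal → w ∈ O := by
  classical
  induction Z using Finset.strongInduction with
  | H Z ih =>
    -- Minimality means that no other chosen prime is contained in `x`, so some homogeneous `c` lies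
    -- in all the others but not in `x`.
    obtain ⟨x, hx⟩ := Z.exists_minimal hne
    obtain ⟨k, hk, b, hb, hbx, hbO⟩ := exists_basicOpen_le hO (hZ x hx.1)
    obtain ⟨i, c, hc, hcZ, hcx⟩ := exists_homogeneous_forall_mem_notMem x (Z.erase x) fun y hy hle ↦
      (Finset.mem_erase.mp hy).1 (le_antisymm hle (hx.2 (Finset.mem_erase.mp hy).2 hle))
    have hbc : b * c ∈ 𝒜 (k + i) := SetLike.mul_mem_graded hb hc
    have hbcx : b * c ∉ x.asHomogeneousIdeal := fun h ↦ (x.isPrime.mem_or_mem h).elim hbx hcx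
    have hbcO (w : ProjectiveSpectrum 𝒜) (hw : w ∉ O) : b * c ∈ w.asHomogeneousIdeal :=
      Ideal.mul_mem_right _ _ (by_contra fun h ↦ hw (hbO w h))
    rcases (Z.erase x).eq_empty_or_nonempty with he | he
    · refine ⟨k + i, by omega, b * c, hbc, fun z hz ↦ ?_, fun w hw ↦
        by_contra fun h ↦ hw (hbcO w h)⟩
      obtain rfl : z = x := by
        by_contra h
        simpa [he] using Finset.mem_erase.mpr ⟨h, hz⟩
      exact hbcx
    · obtain ⟨m, hm, a, ha, haZ, haO⟩ := ih _ (Finset.erase_ssubset hx.1)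
        (fun z hz ↦ hZ z (Finset.mem_of_mem_erase hz)) he
      by_cases hax : a ∈ x.asHomogeneousIdeal
      -- The exponents equalize the degrees. At each chosen point exactly one summand is nonzero:
      -- the second at `x`, the first at the others. Both vanish outside `O`.
      · refine ⟨(k + i) * m, by positivity, a ^ (k + i) + (b * c) ^ m, ?_, fun z hz ↦ ?_,
          fun w hw ↦ by_contra fun h ↦ hw ?_⟩
        · refine add_mem ?_ ?_
          · simpa using SetLike.pow_mem_graded (k + i) ha
          · simpa [mul_comm] using SetLike.pow_mem_graded m hbc
        · rcases eq_or_ne z x with rfl | hzx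
          · intro h
            refine hbcx (z.isPrime.mem_of_pow_mem m ?_)
            exact (Ideal.add_mem_iff_right _ (Ideal.pow_mem_of_mem _ hax _ (by omega))).mp h
          · intro h
            have hz' := Finset.mem_erase.mpr ⟨hzx, hz⟩
            refine haZ z hz' (z.isPrime.mem_of_pow_mem (k + i) ?_)
            exact (Ideal.add_mem_iff_left _
              (Ideal.pow_mem_of_mem _ (Ideal.mul_mem_left _ _ (hcZ z hz')) _ hm)).mp h
        · exact Ideal.add_mem _
            (Ideal.pow_mem_of_mem _ (by_contra fun h' ↦ h (haO w h')) _ (by omega))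
            (Ideal.pow_mem_of_mem _ (hbcO w h) _ hm)
      · refine ⟨m, hm, a, ha, fun z hz ↦ ?_, haO⟩
        rcases eq_or_ne z x with rfl | hzx
        · exact hax
        · exact haZ z (Finset.mem_erase.mpr ⟨hzx, hz⟩)

end ProjectiveSpectrum

end ProjPrimeAvoidance

attribute [local instance] MvPolynomial.gradedAlgebra in
/-- A finite set of points of a locally closed subscheme of projective space is contained in an
affine open. -/
theorem exists_isAffineOpen_of_isImmersion_projSpace {X : Scheme.{u}} {n : ℕ} {R : CommRingCat.{u}}
    (j : X ⟶ projSpace n R) [IsImmersion j] (Z : Set X) (hZ : Z.Finite) :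
    ∃ V : X.Opens, IsAffineOpen V ∧ Z ⊆ V := by
  classical
  rcases Z.eq_empty_or_nonempty with rfl | hne
  · exact ⟨⊥, isAffineOpen_bot X, Set.empty_subset _⟩
  let 𝒜 := MvPolynomial.homogeneousSubmodule (Fin (n + 1)) R
  have hmem (z : X) : j z ∈ j.coborderRange := subset_coborder ⟨z, rfl⟩
  obtain ⟨m, hm, a, ha, haZ, haO⟩ := ProjectiveSpectrum.exists_basicOpen_of_finset (𝒜 := 𝒜)
    (hZ.image j).toFinset (O := (j.coborderRange : Set (projSpace n R))) j.coborderRange.isOpen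
    (fun w hw ↦ by
      obtain ⟨z, -, rfl⟩ := (hZ.image j).mem_toFinset.mp hw
      exact hmem z)
    ((Set.Finite.toFinset_nonempty _).mpr (hne.image j))
  let D : (projSpace n R).Opens := Proj.basicOpen 𝒜 a
  have hD : IsAffineOpen D := Proj.isAffineOpen_basicOpen 𝒜 a ha hm
  have hDle : D ≤ j.coborderRange := fun w hw ↦ haO w hw
  have hD' : IsAffineOpen (j.coborderRange.ι ⁻¹ᵁ D) :=
    hD.preimage_of_isOpenImmersion j.coborderRange.ι (by simpa using hDle)
  refine ⟨j ⁻¹ᵁ D, ?_, fun z hz ↦ haZ (j z) ((hZ.image j).mem_toFinset.mpr ⟨z, hz, rfl⟩)⟩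
  -- `j` is a closed immersion into the open `j.coborderRange`, and `D` was chosen inside that open.
  have := hD'.preimage j.liftCoborder
  rwa [← Scheme.Hom.comp_preimage, Scheme.Hom.liftCoborder_ι] at this

/-! ### The functor of points of the Weil restriction on all schemes, and gluing. -/

section

attribute [local simp] pullback.lift_fst pullback.lift_snd pullback.lift_fst_assoc
  pullback.lift_snd_assoc IsPullback.lift_fst IsPullback.lift_snd

namespace AlgebraicGeometry.Scheme.Cover

variable {P T Y : Scheme.{u}} (𝒰 : T.OpenCover) (q : P ⟶ T)

lemma hom_ext_of_pullback {g g' : P ⟶ Y}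
    (h : ∀ i, pullback.fst q (𝒰.f i) ≫ g = pullback.fst q (𝒰.f i) ≫ g') : g = g' :=
  Scheme.Cover.hom_ext (𝒰.pullback₁ q) g g' h

lemma exists_glue_of_pullback (e : ∀ i, pullback q (𝒰.f i) ⟶ Y)
    (he : ∀ i j {Z : Scheme.{u}} (a : Z ⟶ pullback q (𝒰.f i)) (b : Z ⟶ pullback q (𝒰.f j)),
      a ≫ pullback.fst _ _ = b ≫ pullback.fst _ _ → a ≫ e i = b ≫ e j) :
    ∃ g : P ⟶ Y, ∀ i, pullback.fst q (𝒰.f i) ≫ g = e i :=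
  ⟨Scheme.Cover.glueMorphisms (𝒰.pullback₁ q) e fun i j ↦ he i j _ _ pullback.condition,
    Scheme.Cover.ι_glueMorphisms (𝒰.pullback₁ q) e _⟩

end AlgebraicGeometry.Scheme.Cover

/-- A `T`-valued point of the Weil restriction of `f : X ⟶ S'` along `p : S' ⟶ S`: a morphism
`base : T ⟶ S` and an `S'`-morphism `T ×[S] S' ⟶ X`. -/
structure WeilPoint {S S' X : Scheme.{u}} (p : S' ⟶ S) (f : X ⟶ S') (T : Scheme.{u}) where
  base : T ⟶ S
  map : pullback base p ⟶ X
  w : map ≫ f = pullback.snd base p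

namespace WeilPoint

variable {S S' X : Scheme.{u}} {p : S' ⟶ S} {f : X ⟶ S'} {T T' T'' P Q : Scheme.{u}}

/-- The value of a point of the Weil restriction on a `P`-valued point of `T ×[S] S'`. -/
noncomputable def eval (x : WeilPoint p f T) (q : P ⟶ T) (s : P ⟶ S') (h : q ≫ x.base = s ≫ p) :
    P ⟶ X :=
  pullback.lift q s h ≫ x.map

@[simp]
lemma eval_comp (x : WeilPoint p f T) (q : P ⟶ T) (s : P ⟶ S') (h : q ≫ x.base = s ≫ p) :
    x.eval q s h ≫ f = s := by
  simp [eval, x.w]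

lemma comp_eval (x : WeilPoint p f T) (q : P ⟶ T) (s : P ⟶ S') (h : q ≫ x.base = s ≫ p)
    (e : Q ⟶ P) : e ≫ x.eval q s h = x.eval (e ≫ q) (e ≫ s) (by simp [h]) := by
  rw [eval, eval, ← Category.assoc]
  congr 1
  apply pullback.hom_ext <;> simp

lemma map_eq_eval (x : WeilPoint p f T) :
    x.map = x.eval (pullback.fst _ _) (pullback.snd _ _) pullback.condition := by
  rw [eval, pullback.lift_fst_snd, Category.id_comp]

/-- Equality may be tested on any model `P` of the fibre product, in particular on the spectrum of a
tensor product. -/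
lemma ext_of_eval {x y : WeilPoint p f T} (h : x.base = y.base) {q : P ⟶ T} {s : P ⟶ S'}
    (hP : IsPullback q s x.base p) (hm : x.eval q s hP.w = y.eval q s (h ▸ hP.w)) : x = y := by
  obtain ⟨t, g, hg⟩ := x
  obtain ⟨t', g', hg'⟩ := y
  obtain rfl : t = t' := h
  have : IsIso (pullback.lift q s hP.w) := inferInstanceAs (IsIso hP.isoPullback.hom)
  obtain rfl : g = g' := (cancel_epi _).mp hm
  rfl

lemma ext_eval {x y : WeilPoint p f T} (h : x.base = y.base)
    (H : ∀ {P : Scheme.{u}} (q : P ⟶ T) (s : P ⟶ S') (h₁ : q ≫ x.base = s ≫ p)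
      (h₂ : q ≫ y.base = s ≫ p), x.eval q s h₁ = y.eval q s h₂) : x = y :=
  ext_of_eval h (.of_hasPullback _ _) (H _ _ _ _)

/-- The point of the Weil restriction given by a pullback square. -/
noncomputable def ofIsPullback {t : T ⟶ S} {q : P ⟶ T} {s : P ⟶ S'}
    (h : IsPullback q s t p) (g : P ⟶ X) (hg : g ≫ f = s) : WeilPoint p f T where
  base := t
  map := h.isoPullback.inv ≫ g
  w := by simp [hg]

lemma ofIsPullback_eval {t : T ⟶ S} {q : P ⟶ T} {s : P ⟶ S'}
    (h : IsPullback q s t p) (g : P ⟶ X) (hg : g ≫ f = s) (q' : Q ⟶ T) (s' : Q ⟶ S')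
    (h' : q' ≫ t = s' ≫ p) : (ofIsPullback h g hg).eval q' s' h' = h.lift q' s' h' ≫ g := by
  simp only [eval, ofIsPullback, ← Category.assoc]
  congr 1
  apply h.hom_ext
  · rw [Category.assoc, h.isoPullback_inv_fst, h.lift_fst]
    exact pullback.lift_fst _ _ _
  · rw [Category.assoc, h.isoPullback_inv_snd, h.lift_snd]
    exact pullback.lift_snd _ _ _

lemma ofIsPullback_eval_self {t : T ⟶ S} {q : P ⟶ T} {s : P ⟶ S'}
    (h : IsPullback q s t p) (g : P ⟶ X) (hg : g ≫ f = s) :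
    (ofIsPullback h g hg).eval q s h.w = g := by
  rw [ofIsPullback_eval, show h.lift q s h.w = 𝟙 P from h.hom_ext (by simp) (by simp),
    Category.id_comp]

/-- The restriction of a point of the Weil restriction along `T' ⟶ T`. -/
noncomputable def restrict (x : WeilPoint p f T) (h : T' ⟶ T) : WeilPoint p f T' where
  base := h ≫ x.base
  map := x.eval (pullback.fst _ _ ≫ h) (pullback.snd _ _) (by simp [pullback.condition])
  w := by simp

@[simp]
lemma restrict_base (x : WeilPoint p f T) (h : T' ⟶ T) : (x.restrict h).base = h ≫ x.base := rfl

@[simp]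
lemma restrict_eval (x : WeilPoint p f T) (h : T' ⟶ T) (q : P ⟶ T') (s : P ⟶ S')
    (hq : q ≫ (x.restrict h).base = s ≫ p) :
    (x.restrict h).eval q s hq = x.eval (q ≫ h) s (by simpa using hq) := by
  simp only [eval, restrict, ← Category.assoc]
  congr 1
  apply pullback.hom_ext
  · rw [Category.assoc, pullback.lift_fst, pullback.lift_fst]
    exact pullback.lift_fst_assoc _ _ _ _
  · rw [Category.assoc, pullback.lift_snd, pullback.lift_snd]
    exact pullback.lift_snd _ _ _

lemma restrict_id (x : WeilPoint p f T) : x.restrict (𝟙 T) = x :=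
  ext_of_eval (by simp) (.of_hasPullback _ _) (by simp)

lemma restrict_comp (x : WeilPoint p f T) (h : T' ⟶ T) (h' : T'' ⟶ T') :
    x.restrict (h' ≫ h) = (x.restrict h).restrict h' :=
  ext_of_eval (by simp) (.of_hasPullback _ _) (by simp)

lemma eval_congr {x y : WeilPoint p f T} (hxy : x = y) (q : P ⟶ T) (s : P ⟶ S')
    (h : q ≫ x.base = s ≫ p) : x.eval q s h = y.eval q s (hxy ▸ h) := by
  subst hxy; rfl

/-- Points of the Weil restriction are determined by their restrictions to an open cover. -/
lemma ext_of_openCover (𝒰 : T.OpenCover) {x y : WeilPoint p f T}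
    (h : ∀ i, x.restrict (𝒰.f i) = y.restrict (𝒰.f i)) : x = y := by
  have hb : x.base = y.base := 𝒰.hom_ext _ _ fun i ↦ congr_arg base (h i)
  refine ext_of_eval hb (.of_hasPullback _ _) ?_
  refine Scheme.Cover.hom_ext_of_pullback 𝒰 (pullback.fst x.base p) fun i ↦ ?_
  rw [comp_eval, comp_eval]
  have := eval_congr (h i) (pullback.snd (pullback.fst x.base p) (𝒰.f i))
    (pullback.fst _ _ ≫ pullback.snd _ _)
    (by simp [← pullback.condition_assoc, pullback.condition])
  simp only [restrict_eval] at this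
  convert! this using 2
  all_goals exact pullback.condition

/-- Points of the Weil restriction can be glued along an open cover. -/
lemma exists_glue (𝒰 : T.OpenCover) (x : ∀ i, WeilPoint p f (𝒰.X i))
    (h : ∀ i j, (x i).restrict (pullback.fst (𝒰.f i) (𝒰.f j)) =
      (x j).restrict (pullback.snd (𝒰.f i) (𝒰.f j))) :
    ∃ y : WeilPoint p f T, ∀ i, y.restrict (𝒰.f i) = x i := by
  let t : T ⟶ S := 𝒰.glueMorphisms (fun i ↦ (x i).base) fun i j ↦ congr_arg base (h i j)
  have ht (i) : 𝒰.f i ≫ t = (x i).base := 𝒰.ι_glueMorphisms _ _ i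
  have hcond (i) : pullback.snd (pullback.fst t p) (𝒰.f i) ≫ (x i).base =
      (pullback.fst (pullback.fst t p) (𝒰.f i) ≫ pullback.snd t p) ≫ p := by
    rw [← ht, ← pullback.condition_assoc, Category.assoc, pullback.condition]
  obtain ⟨g, hg⟩ := Scheme.Cover.exists_glue_of_pullback 𝒰 (pullback.fst t p)
    (fun i ↦ (x i).eval (pullback.snd _ _) (pullback.fst _ _ ≫ pullback.snd _ _) (hcond i))
    fun i j Z a b hab ↦ by
      have hl : (a ≫ pullback.snd _ _) ≫ 𝒰.f i = (b ≫ pullback.snd _ _) ≫ 𝒰.f j := by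
        rw [Category.assoc, ← pullback.condition, Category.assoc, ← pullback.condition,
          reassoc_of% hab]
      have := eval_congr (h i j) (pullback.lift _ _ hl) (a ≫ pullback.fst _ _ ≫ pullback.snd _ _)
        (by
          simp only [restrict_base, pullback.lift_fst_assoc, Category.assoc]
          rw [hcond, Category.assoc])
      simp only [restrict_eval, pullback.lift_fst, pullback.lift_snd] at this
      rw [comp_eval, comp_eval, this]
      congr 1
      exact (Category.assoc _ _ _).symm.trans (hab ▸ Category.assoc _ _ _)
  let y : WeilPoint p f T := ⟨t, g, Scheme.Cover.hom_ext_of_pullback 𝒰 (pullback.fst t p) fun i ↦ by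
    rw [reassoc_of% hg i, eval_comp]⟩
  have key (i) {P : Scheme.{u}} (q : P ⟶ 𝒰.X i) (s : P ⟶ S') (h : (q ≫ 𝒰.f i) ≫ t = s ≫ p) :
      y.eval (q ≫ 𝒰.f i) s h = (x i).eval q s (by rw [← h, Category.assoc, ht]) := by
    change pullback.lift (q ≫ 𝒰.f i) s h ≫ g = _
    let m : P ⟶ pullback (pullback.fst t p) (𝒰.f i) :=
      pullback.lift (pullback.lift (q ≫ 𝒰.f i) s h) q (by simp)
    have hm : m ≫ pullback.fst _ _ = pullback.lift (q ≫ 𝒰.f i) s h := pullback.lift_fst _ _ _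
    have hm' : m ≫ pullback.snd _ _ = q := pullback.lift_snd _ _ _
    have hm'' : m ≫ pullback.fst _ _ ≫ pullback.snd _ _ = s := by
      rw [reassoc_of% hm, pullback.lift_snd]
    rw [← hm, Category.assoc, hg, comp_eval]
    congr 1
  refine ⟨y, fun i ↦ ext_of_eval (ht i) (.of_hasPullback _ _) ?_⟩
  rw [restrict_eval]
  exact key i _ _ _

end WeilPoint

end

/-! ### Charts of the Weil restriction. -/

namespace WeilPoint

variable {S S' X U : Scheme.{u}} {p : S' ⟶ S} {f : X ⟶ S'} {T T' Y W P : Scheme.{u}}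

/-- The image of a point of the Weil restriction under a morphism `a : U ⟶ X`. -/
noncomputable def mapTarget (a : U ⟶ X) (x : WeilPoint p (a ≫ f) T) : WeilPoint p f T where
  base := x.base
  map := x.map ≫ a
  w := by simpa using x.w

lemma mapTarget_eval (a : U ⟶ X) (x : WeilPoint p (a ≫ f) T) (q : P ⟶ T) (s : P ⟶ S')
    (h : q ≫ (x.mapTarget a).base = s ≫ p) : (x.mapTarget a).eval q s h = x.eval q s h ≫ a :=
  (Category.assoc _ _ _).symm

lemma mapTarget_restrict (a : U ⟶ X) (x : WeilPoint p (a ≫ f) T) (h : T' ⟶ T) :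
    (x.mapTarget a).restrict h = (x.restrict h).mapTarget a :=
  ext_eval rfl fun q s h₁ h₂ ↦ by
    rw [restrict_eval, mapTarget_eval, mapTarget_eval]
    exact congr_arg (· ≫ a) (restrict_eval x h q s h₂).symm

lemma mapTarget_injective (a : U ⟶ X) [Mono a] {x y : WeilPoint p (a ≫ f) T}
    (h : x.mapTarget a = y.mapTarget a) : x = y := by
  refine ext_of_eval (congr_arg (fun z ↦ z.base) h) (.of_hasPullback _ _) ?_
  rw [← cancel_mono a]
  exact eval_congr h _ _ _

lemma exists_mapTarget_eq (a : U ⟶ X) [IsOpenImmersion a] (x : WeilPoint p f T)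
    (h : ∀ z, x.map z ∈ a.opensRange) : ∃ y : WeilPoint p (a ≫ f) T, y.mapTarget a = x := by
  have hr : Set.range x.map ⊆ Set.range a := by
    rintro _ ⟨z, rfl⟩
    exact h z
  refine ⟨⟨x.base, IsOpenImmersion.lift a x.map hr, by
    rw [IsOpenImmersion.lift_fac_assoc, x.w]⟩, ?_⟩
  obtain ⟨t, g, hg⟩ := x
  simp only [mapTarget, mk.injEq, heq_eq_eq, true_and]
  exact IsOpenImmersion.lift_fac _ _ _

/-- The `T`-point `x` lies over the open `A` of the base and takes values in the open `V` of the
target. -/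
structure InChart (x : WeilPoint p f T) (A : S.Opens) (V : X.Opens) : Prop where
  base_mem : ∀ τ, x.base τ ∈ A
  map_mem : ∀ z, x.map z ∈ V

/-- The open subset of `T` over which the `T`-point `x` lies in the chart given by `A` and `V`. -/
noncomputable def chartLocus [IsFinite p] (x : WeilPoint p f T) (A : S.Opens) (V : X.Opens) :
    T.Opens where
  carrier := {τ | x.base τ ∈ A ∧ ∀ z, pullback.fst x.base p z = τ → x.map z ∈ V}
  is_open' := by
    -- The points with a bad value above them form the image of a closed set under a base change of
    -- the finite morphism `p`, which is closed.
    have h : IsOpen (pullback.fst x.base p '' (x.map ⁻¹ᵁ V : Set _)ᶜ)ᶜ :=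
      ((pullback.fst x.base p).isClosedMap _ (x.map ⁻¹ᵁ V).isOpen.isClosed_compl).isOpen_compl
    convert (x.base ⁻¹ᵁ A).isOpen.inter h using 1
    ext τ
    simp only [Set.mem_ofPred_eq, Set.mem_inter_iff, Set.mem_compl_iff, Set.mem_image, not_exists,
      not_and, SetLike.mem_coe, Scheme.Hom.mem_preimage]
    grind

/-- The fibre over `τ` surjects onto the fibre over `h τ`, since two points with a common image
always lift to the fibre product. So the two fibres impose the same condition. -/
lemma mem_chartLocus_restrict [IsFinite p] {x : WeilPoint p f T} {A : S.Opens} {V : X.Opens}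
    (h : T' ⟶ T) (τ : T') : τ ∈ (x.restrict h).chartLocus A V ↔ h τ ∈ x.chartLocus A V := by
  let l : pullback (h ≫ x.base) p ⟶ pullback x.base p :=
    pullback.lift (pullback.fst _ _ ≫ h) (pullback.snd _ _) (by simp [pullback.condition])
  have hl : l ≫ pullback.fst _ _ = pullback.fst _ _ ≫ h := pullback.lift_fst _ _ _
  have hl' : l ≫ pullback.snd _ _ = pullback.snd _ _ := pullback.lift_snd _ _ _
  have hmap (z : ↥(pullback (h ≫ x.base) p)) : (x.restrict h).map z = x.map (l z) :=
    Scheme.Hom.comp_apply _ _ _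
  have hpb : IsPullback l (pullback.fst (h ≫ x.base) p) (pullback.fst x.base p) h := by
    refine .of_right (h₁₂ := pullback.snd x.base p) (h₂₂ := x.base) (v₁₃ := p) ?_ hl
      (IsPullback.of_hasPullback _ _).flip
    rw [hl']
    exact (IsPullback.of_hasPullback _ _).flip
  refine and_congr (by simp) ⟨fun H z hz ↦ ?_, fun H (z : ↥(pullback (h ≫ x.base) p)) hz ↦ ?_⟩
  · obtain ⟨z', hz', hz''⟩ := Scheme.exists_preimage_of_isPullback hpb z τ hz
    rw [← hz', ← hmap]
    exact H z' hz''
  · rw [hmap]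
    refine H _ ?_
    rw [← Scheme.Hom.comp_apply, hl, Scheme.Hom.comp_apply]
    exact congr_arg h hz

lemma inChart_iff_forall [IsFinite p] {x : WeilPoint p f T} {A : S.Opens} {V : X.Opens} :
    x.InChart A V ↔ ∀ τ, τ ∈ x.chartLocus A V :=
  ⟨fun h τ ↦ ⟨h.1 τ, fun z _ ↦ h.2 z⟩, fun h ↦ ⟨fun τ ↦ (h τ).1, fun z ↦ (h _).2 z rfl⟩⟩

lemma inChart_restrict_iff [IsFinite p] {x : WeilPoint p f T} {A : S.Opens} {V : X.Opens}
    (h : T' ⟶ T) : (x.restrict h).InChart A V ↔ ∀ τ, h τ ∈ x.chartLocus A V := by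
  simp only [inChart_iff_forall, mem_chartLocus_restrict]

lemma InChart.restrict [IsFinite p] {x : WeilPoint p f T} {A : S.Opens} {V : X.Opens}
    (hx : x.InChart A V) (h : T' ⟶ T) : (x.restrict h).InChart A V :=
  (inChart_restrict_iff h).mpr fun _ ↦ inChart_iff_forall.mp hx _

/-- The point `u` of the Weil restriction over `W` represents the functor of points lying over `A`
with values in `V`. -/
structure IsChart (u : WeilPoint p f W) (A : S.Opens) (V : X.Opens) : Prop where
  inChart : u.InChart A V
  existsUnique : ∀ ⦃T : Scheme.{u}⦄ (y : WeilPoint p f T), y.InChart A V →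
    ∃! h : T ⟶ W, u.restrict h = y

/-- The point `x` of the Weil restriction over `Y` represents the Weil restriction. -/
def IsUniversal (x : WeilPoint p f Y) : Prop :=
  ∀ ⦃T : Scheme.{u}⦄ (y : WeilPoint p f T), ∃! h : T ⟶ Y, x.restrict h = y

lemma IsChart.hom_ext {u : WeilPoint p f W} {A : S.Opens} {V : X.Opens} [IsFinite p]
    (hu : u.IsChart A V) {h h' : T ⟶ W} (H : u.restrict h = u.restrict h') : h = h' :=
  (hu.existsUnique (u.restrict h') (hu.inChart.restrict h')).unique H rfl

lemma IsUniversal.hom_ext {x : WeilPoint p f Y} (hx : x.IsUniversal) {h h' : T ⟶ Y}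
    (H : x.restrict h = x.restrict h') : h = h' :=
  (hx (x.restrict h')).unique H rfl

lemma IsChart.exists_of_chartLocus [IsFinite p] {u : WeilPoint p f W} {A : S.Opens} {V : X.Opens}
    (hu : u.IsChart A V) (x : WeilPoint p f T) :
    ∃ g : (x.chartLocus A V).toScheme ⟶ W, u.restrict g = x.restrict (x.chartLocus A V).ι :=
  (hu.existsUnique _ ((inChart_restrict_iff _).mpr (Subtype.property ·))).exists

/-- Charts are open immersions. -/
theorem IsUniversal.isOpenImmersion_of_isChart [IsFinite p] {x : WeilPoint p f Y}
    (hx : x.IsUniversal) {u : WeilPoint p f W} {A : S.Opens} {V : X.Opens} (hu : u.IsChart A V)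
    (h : W ⟶ Y) (hh : x.restrict h = u) :
    IsOpenImmersion h ∧ Set.range h = x.chartLocus A V := by
  obtain ⟨g, hg⟩ := hu.exists_of_chartLocus x
  have hmem : ∀ w, h w ∈ x.chartLocus A V :=
    (inChart_restrict_iff h).mp (hh ▸ hu.inChart)
  have hr : Set.range h ⊆ Set.range (x.chartLocus A V).ι := by
    rw [Scheme.Opens.range_ι]
    rintro _ ⟨w, rfl⟩
    exact hmem w
  let h' : W ⟶ x.chartLocus A V := IsOpenImmersion.lift (x.chartLocus A V).ι h hr
  have hh' : h' ≫ (x.chartLocus A V).ι = h := IsOpenImmersion.lift_fac _ _ _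
  -- That `g` and `h'` are mutually inverse follows from uniqueness, once for `Y` and once for the
  -- chart.
  have hgh : g ≫ h = (x.chartLocus A V).ι := hx.hom_ext (by rw [restrict_comp, hh, hg])
  have h1 : g ≫ h' = 𝟙 _ := by
    rw [← cancel_mono (x.chartLocus A V).ι, Category.assoc, hh', hgh, Category.id_comp]
  have h2 : h' ≫ g = 𝟙 _ := hu.hom_ext (by
    rw [restrict_comp, hg, ← restrict_comp, hh', hh, restrict_id])
  have : IsIso h' := ⟨g, h2, h1⟩
  rw [← hh']
  refine ⟨inferInstance, ?_⟩
  rw [Scheme.Hom.comp_base, TopCat.coe_comp, Set.range_comp,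
    Set.range_eq_univ.mpr h'.surjective, Set.image_univ, Scheme.Opens.range_ι]

/-- An open immersion `a : U ⟶ X` makes the Weil restriction of `U` a chart of the one of `X`. -/
lemma IsUniversal.isChart_mapTarget [IsFinite p] {a : U ⟶ X} [IsOpenImmersion a]
    {x : WeilPoint p (a ≫ f) Y}
    (hx : x.IsUniversal) : (x.mapTarget a).IsChart ⊤ a.opensRange where
  inChart := ⟨fun _ ↦ trivial, fun z ↦ ⟨x.map z, (Scheme.Hom.comp_apply _ _ _).symm⟩⟩
  existsUnique T y hy := by
    obtain ⟨y, rfl⟩ := exists_mapTarget_eq a y hy.map_mem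
    obtain ⟨h, hh, huniq⟩ := hx y
    refine ⟨h, (mapTarget_restrict a x h).trans (by rw [hh]), fun h' hh' ↦ huniq h' ?_⟩
    exact mapTarget_injective a ((mapTarget_restrict a x h').symm.trans hh')

/-- If `u` has the universal property of a chart for affine test schemes, it has it for all. -/
lemma isChart_of_forall_affine [IsFinite p] {u : WeilPoint p f W} {A : S.Opens} {V : X.Opens}
    (hu : u.InChart A V) (H : ∀ (R : CommRingCat.{u}) (y : WeilPoint p f (Spec R)), y.InChart A V →
      ∃! h : Spec R ⟶ W, u.restrict h = y) : u.IsChart A V where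
  inChart := hu
  existsUnique T y hy := by
    have H' {T : Scheme.{u}} [IsAffine T] (y : WeilPoint p f T) (hy : y.InChart A V) :
        ∃! h : T ⟶ W, u.restrict h = y := by
      obtain ⟨h, hh, huniq⟩ := H _ (y.restrict T.isoSpec.inv) (hy.restrict _)
      refine ⟨T.isoSpec.hom ≫ h, ?_, fun h' hh' ↦ ?_⟩
      · change u.restrict (T.isoSpec.hom ≫ h) = y
        rw [restrict_comp, show u.restrict h = _ from hh, ← restrict_comp, Iso.hom_inv_id,
          restrict_id]
      · rw [← huniq (T.isoSpec.inv ≫ h') ((restrict_comp _ _ _).trans (by rw [hh'])),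
          Iso.hom_inv_id_assoc]
    have huniq {T : Scheme.{u}} {h h' : T ⟶ W} (hh : u.restrict h = u.restrict h') : h = h' :=
      T.affineCover.hom_ext _ _ fun i ↦
        (H' (u.restrict (T.affineCover.f i ≫ h')) (hu.restrict _)).unique
          ((restrict_comp _ _ _).trans (by rw [hh, restrict_comp])) rfl
    choose h hh using fun i ↦ (H' (y.restrict (T.affineCover.f i)) (hy.restrict _)).exists
    let g : T ⟶ W := T.affineCover.glueMorphisms h fun i j ↦ huniq (by
      rw [restrict_comp, hh, restrict_comp, hh, ← restrict_comp, ← restrict_comp,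
        pullback.condition])
    have hg (i) : T.affineCover.f i ≫ g = h i := T.affineCover.ι_glueMorphisms _ _ i
    have hgy : u.restrict g = y := ext_of_openCover T.affineCover fun i ↦ by
      rw [← restrict_comp, hg, hh]
    exact ⟨g, hgy, fun g' hg' ↦ huniq (hg'.trans hgy.symm)⟩

end WeilPoint

/-! ### Affine charts from algebra homomorphisms, and the codimension inequality. -/

namespace WeilPoint

section Affine

open WeilRestriction

variable {S S' X : Scheme.{u}} {p : S' ⟶ S} {f : X ⟶ S'}
  {R R' C W : Type u} [CommRing R] [CommRing R'] [CommRing C] [CommRing W]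
  [Algebra R R'] [Algebra R' C] [Algebra R W]
  {i : Spec (.of R) ⟶ S} {i' : Spec (.of R') ⟶ S'} {k : Spec (.of C) ⟶ X}

lemma isPullback_Spec_tensorProduct
    (hp : IsPullback (Spec.map (CommRingCat.ofHom (algebraMap R R'))) i' i p)
    (B : Type u) [CommRing B] [Algebra R B] :
    IsPullback
      (Spec.map (CommRingCat.ofHom
        (Algebra.TensorProduct.includeRight (R := R) (A := R') (B := B)).toRingHom))
      (Spec.map (CommRingCat.ofHom
        (Algebra.TensorProduct.includeLeftRingHom (R := R) (A := R') (B := B))) ≫ i')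
      (Spec.map (CommRingCat.ofHom (algebraMap R B)) ≫ i) p :=
  (isPullback_SpecMap_of_isPushout _ _ _ _
    (CommRingCat.isPushout_tensorProduct R R' B)).flip.paste_vert hp

lemma _root_.AlgebraicGeometry.ringHom_comp_eq_of_Spec {A B E : Type u} [CommRing A] [CommRing B]
    [CommRing E] {Z : Scheme.{u}} (m : Spec (.of A) ⟶ Z) [Mono m] {e : A →+* B}
    {g : A →+* E} {ψ : CommRingCat.of B ⟶ CommRingCat.of E}
    (h : Spec.map ψ ≫ Spec.map (CommRingCat.ofHom e) ≫ m = Spec.map (CommRingCat.ofHom g) ≫ m) :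
    ψ.hom.comp e = g := by
  rw [← Spec.map_comp_assoc, cancel_mono] at h
  exact congr_arg CommRingCat.Hom.hom (Spec.map_injective h)

lemma eval_congr_args {S S' X P T : Scheme.{u}} {p : S' ⟶ S} {f : X ⟶ S'}
    (x : WeilPoint p f T) {q q' : P ⟶ T} {s s' : P ⟶ S'} (hq : q = q') (hs : s = s')
    (h : q ≫ x.base = s ≫ p) (h' : q' ≫ x.base = s' ≫ p) : x.eval q s h = x.eval q' s' h' := by
  subst hq hs; rfl

lemma algHom_comp_eq {B : Type u} [CommRing B] [Algebra R B]
    (hf : k ≫ f = Spec.map (CommRingCat.ofHom (algebraMap R' C)) ≫ i')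
    (ψ : C →ₐ[R'] R' ⊗[R] B) :
    (Spec.map (CommRingCat.ofHom ψ.toRingHom) ≫ k) ≫ f =
      Spec.map (CommRingCat.ofHom
        (Algebra.TensorProduct.includeLeftRingHom (R := R) (A := R') (B := B))) ≫ i' := by
  rw [Category.assoc, hf, ← Spec.map_comp_assoc, ← CommRingCat.ofHom_comp]
  congr 3
  exact ψ.comp_algebraMap

/-- The point of the Weil restriction with values in `Spec B` given by an algebra homomorphism
`C → R' ⊗ B`. -/
noncomputable def ofAlgHom (hp : IsPullback (Spec.map (CommRingCat.ofHom (algebraMap R R'))) i' i p)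
    (hf : k ≫ f = Spec.map (CommRingCat.ofHom (algebraMap R' C)) ≫ i')
    {B : Type u} [CommRing B] [Algebra R B] (ψ : C →ₐ[R'] R' ⊗[R] B) :
    WeilPoint p f (Spec (.of B)) :=
  ofIsPullback (isPullback_Spec_tensorProduct hp B) (Spec.map (CommRingCat.ofHom ψ.toRingHom) ≫ k)
    (algHom_comp_eq hf ψ)

variable (hp : IsPullback (Spec.map (CommRingCat.ofHom (algebraMap R R'))) i' i p)
    (hf : k ≫ f = Spec.map (CommRingCat.ofHom (algebraMap R' C)) ≫ i')
    {B : Type u} [CommRing B] [Algebra R B]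

lemma ofAlgHom_base (ψ : C →ₐ[R'] R' ⊗[R] B) :
    (ofAlgHom hp hf ψ).base = Spec.map (CommRingCat.ofHom (algebraMap R B)) ≫ i := rfl

lemma ofAlgHom_eval (ψ : C →ₐ[R'] R' ⊗[R] B) :
    (ofAlgHom hp hf ψ).eval _ _ (isPullback_Spec_tensorProduct hp B).w =
      Spec.map (CommRingCat.ofHom ψ.toRingHom) ≫ k :=
  ofIsPullback_eval_self _ _ _

lemma ofAlgHom_restrict (φ : C →ₐ[R'] R' ⊗[R] W) (θ : W →ₐ[R] B) :
    (ofAlgHom hp hf φ).restrict (Spec.map (CommRingCat.ofHom θ.toRingHom)) =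
      ofAlgHom hp hf ((baseChangeHom R' θ).comp φ) := by
  have hb : Spec.map (CommRingCat.ofHom θ.toRingHom) ≫
      Spec.map (CommRingCat.ofHom (algebraMap R W)) ≫ i =
        Spec.map (CommRingCat.ofHom (algebraMap R B)) ≫ i := by
    rw [← Spec.map_comp_assoc, ← CommRingCat.ofHom_comp]
    congr 3
    exact θ.comp_algebraMap
  symm
  refine ext_of_eval hb.symm (isPullback_Spec_tensorProduct hp B) ?_
  rw [ofAlgHom_eval, restrict_eval]
  have h₁ : Spec.map (CommRingCat.ofHom (baseChangeHom R' θ).toRingHom) ≫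
      Spec.map (CommRingCat.ofHom
        (Algebra.TensorProduct.includeRight (R := R) (A := R') (B := W)).toRingHom) =
      Spec.map (CommRingCat.ofHom
        (Algebra.TensorProduct.includeRight (R := R) (A := R') (B := B)).toRingHom) ≫
        Spec.map (CommRingCat.ofHom θ.toRingHom) := by
    rw [← Spec.map_comp, ← Spec.map_comp, ← CommRingCat.ofHom_comp, ← CommRingCat.ofHom_comp]
    congr 2
  have h₂ : Spec.map (CommRingCat.ofHom (baseChangeHom R' θ).toRingHom) ≫
      Spec.map (CommRingCat.ofHom
        (Algebra.TensorProduct.includeLeftRingHom (R := R) (A := R') (B := W))) =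
      Spec.map (CommRingCat.ofHom
        (Algebra.TensorProduct.includeLeftRingHom (R := R) (A := R') (B := B))) := by
    rw [← Spec.map_comp, ← CommRingCat.ofHom_comp]
    congr 2
    exact RingHom.ext fun r ↦ by simp
  have h₃ : Spec.map (CommRingCat.ofHom ((baseChangeHom R' θ).comp φ).toRingHom) ≫ k =
      Spec.map (CommRingCat.ofHom (baseChangeHom R' θ).toRingHom) ≫
        Spec.map (CommRingCat.ofHom φ.toRingHom) ≫ k := by
    rw [← Spec.map_comp_assoc, ← CommRingCat.ofHom_comp]
    rfl
  have h₄ := (congr_arg (Spec.map (CommRingCat.ofHom (baseChangeHom R' θ).toRingHom) ≫ ·)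
    (ofAlgHom_eval hp hf φ)).symm.trans (comp_eval _ _ _ _ _)
  exact (h₃.trans h₄).trans
    (eval_congr_args _ h₁ ((Category.assoc _ _ _).symm.trans (congr_arg (· ≫ i') h₂)) _ _)

lemma ofAlgHom_injective [Mono k] {ψ ψ' : C →ₐ[R'] R' ⊗[R] B}
    (h : ofAlgHom hp hf ψ = ofAlgHom hp hf ψ') : ψ = ψ' := by
  have := eval_congr h _ _ (isPullback_Spec_tensorProduct hp B).w
  rw [ofAlgHom_eval, ofAlgHom_eval, cancel_mono] at this
  exact AlgHom.coe_ringHom_injective (congr_arg CommRingCat.Hom.hom (Spec.map_injective this))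

/-- Values in the open `Spec C` give a ring homomorphism out of `C`. It is `R'`-linear because
compatibility with `f` can be cancelled against `i'`, a monomorphism as a base change of `i`. -/
lemma exists_ofAlgHom_eq [Mono i] [IsOpenImmersion k] (y : WeilPoint p f (Spec (.of B)))
    (hb : y.base = Spec.map (CommRingCat.ofHom (algebraMap R B)) ≫ i)
    (hk : ∀ z, y.map z ∈ k.opensRange) : ∃ ψ : C →ₐ[R'] R' ⊗[R] B, ofAlgHom hp hf ψ = y := by
  have : Mono i' := PullbackCone.mono_snd_of_is_pullback_of_mono hp.isLimit
  let g := y.eval _ _ (hb ▸ (isPullback_Spec_tensorProduct hp B).w)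
  have hg : g ≫ f = _ := eval_comp _ _ _ _
  have hr : Set.range g ⊆ Set.range k := by
    rintro _ ⟨z, rfl⟩
    change (pullback.lift _ _ _ ≫ y.map) z ∈ _
    rw [Scheme.Hom.comp_apply]
    exact hk _
  let g' := IsOpenImmersion.lift k g hr
  have hg' : g' ≫ k = g := IsOpenImmersion.lift_fac _ _ _
  obtain ⟨ψ, hψ⟩ := Spec.map_surjective g'
  have hψalg : ψ.hom.comp (algebraMap R' C) =
      Algebra.TensorProduct.includeLeftRingHom (R := R) (A := R') (B := B) := by
    refine ringHom_comp_eq_of_Spec i' ?_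
    rw [← hg, ← hg', Category.assoc, hf, hψ]
  let ψ' : C →ₐ[R'] R' ⊗[R] B := { ψ.hom with commutes' := fun r ↦ RingHom.congr_fun hψalg r }
  refine ⟨ψ', ext_of_eval hb.symm (isPullback_Spec_tensorProduct hp B) ?_⟩
  rw [ofAlgHom_eval]
  change Spec.map ψ ≫ k = g
  rw [hψ, hg']

theorem ofAlgHom_isChart [IsFinite p] [IsOpenImmersion i] [IsOpenImmersion k]
    {φ : C →ₐ[R'] R' ⊗[R] W} (hφ : WeilRestriction.IsUniversal φ) :
    (ofAlgHom hp hf φ).IsChart i.opensRange k.opensRange := by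
  refine isChart_of_forall_affine ⟨fun τ ↦ ⟨_, (Scheme.Hom.comp_apply _ _ _).symm⟩,
    fun (z : ↥(pullback (Spec.map (CommRingCat.ofHom (algebraMap R W)) ≫ i) p)) ↦
      ⟨_, ((Scheme.Hom.comp_apply _ _ _).trans (Scheme.Hom.comp_apply _ _ _)).symm⟩⟩
    fun B y hy ↦ ?_
  · have hr : Set.range y.base ⊆ Set.range i := by
      rintro _ ⟨τ, rfl⟩
      exact hy.base_mem τ
    obtain ⟨ρ, hρ⟩ := Spec.map_surjective (IsOpenImmersion.lift i y.base hr)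
    have hρi : Spec.map ρ ≫ i = y.base := by rw [hρ, IsOpenImmersion.lift_fac]
    -- The base morphism of the test point factors through `Spec R` and supplies the `R`-algebra
    -- structure.
    let : Algebra R B := ρ.hom.toAlgebra
    have hb : y.base = Spec.map (CommRingCat.ofHom (algebraMap R B)) ≫ i := hρi.symm
    obtain ⟨ψ, rfl⟩ := exists_ofAlgHom_eq hp hf (B := B) y hb hy.map_mem
    obtain ⟨θ, hθ, huniq⟩ := hφ B ψ
    refine ⟨Spec.map (CommRingCat.ofHom θ.toRingHom), ?_, fun h hh ↦ ?_⟩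
    · exact (ofAlgHom_restrict hp hf φ θ).trans (congr_arg _ hθ)
    · obtain ⟨θ', rfl⟩ := Spec.map_surjective h
      have hθ'alg : θ'.hom.comp (algebraMap R W) = algebraMap R B := by
        exact ringHom_comp_eq_of_Spec i
          ((congr_arg WeilPoint.base hh).trans (ofAlgHom_base hp hf ψ))
      let θ'' : W →ₐ[R] B := { θ'.hom with commutes' := fun r ↦ RingHom.congr_fun hθ'alg r }
      have : θ'' = θ := huniq _ (ofAlgHom_injective hp hf
        ((ofAlgHom_restrict hp hf φ θ'').symm.trans hh))
      rw [← this]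
      rfl

lemma _root_.AlgebraicGeometry.ringKrullDim_stalk_Spec {R : Type u} [CommRing R]
    (x : Spec (.of R)) : ringKrullDim ((Spec (.of R)).presheaf.stalk x) = x.asIdeal.height :=
  have : x.asIdeal.IsPrime := PrimeSpectrum.isPrime x
  let : Algebra R ((Spec (.of R)).presheaf.stalk x) := StructureSheaf.stalkAlgebra R x
  have : IsLocalization.AtPrime ((Spec (.of R)).presheaf.stalk x) x.asIdeal :=
    StructureSheaf.IsLocalization.to_stalk R x
  IsLocalization.AtPrime.ringKrullDim_eq_height x.asIdeal ((Spec (.of R)).presheaf.stalk x)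

lemma _root_.AlgebraicGeometry.ringKrullDim_stalk_of_isOpenImmersion {X Y : Scheme.{u}} (f : X ⟶ Y)
    [IsOpenImmersion f] (x : X) :
    ringKrullDim (Y.presheaf.stalk (f x)) = ringKrullDim (X.presheaf.stalk x) :=
  ringKrullDim_eq_of_ringEquiv (asIso (f.stalkMap x)).commRingCatIsoToRingEquiv

/-- Compare both sides with the height of the prime of `R' ⊗ W` at `z`: the flat map `φ` bounds the
left side by it, and the integral map `W → R' ⊗ W` bounds it by the right side. -/
theorem ringKrullDim_stalk_ofAlgHom_le [IsOpenImmersion k] [Algebra.IsIntegral R R']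
    {φ : C →ₐ[R'] R' ⊗[R] W} (hφ : φ.toRingHom.Flat)
    (z : ↥(pullback (ofAlgHom hp hf φ).base p)) :
    ringKrullDim (X.presheaf.stalk ((ofAlgHom hp hf φ).map z)) ≤
      ringKrullDim ((Spec (.of W)).presheaf.stalk
        (pullback.fst (ofAlgHom hp hf φ).base p z)) := by
  let P := isPullback_Spec_tensorProduct hp W
  let z' : Spec (.of (R' ⊗[R] W)) := P.isoPullback.inv z
  have : z'.asIdeal.IsPrime := PrimeSpectrum.isPrime z'
  have h₁ : (ofAlgHom hp hf φ).map z = k (Spec.map (CommRingCat.ofHom φ.toRingHom) z') :=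
    (Scheme.Hom.comp_apply P.isoPullback.inv (Spec.map _ ≫ k) z).trans (Scheme.Hom.comp_apply _ _ _)
  have h₂ : pullback.fst (ofAlgHom hp hf φ).base p z = Spec.map (CommRingCat.ofHom
        (Algebra.TensorProduct.includeRight (R := R) (A := R') (B := W)).toRingHom) z' :=
    (congr_arg (fun h : _ ⟶ Spec (.of W) ↦ h z) P.isoPullback_inv_fst).symm.trans
      (Scheme.Hom.comp_apply _ _ _)
  rw [h₁, h₂, ringKrullDim_stalk_of_isOpenImmersion, ringKrullDim_stalk_Spec,
    ringKrullDim_stalk_Spec]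
  refine WithBot.coe_le_coe.mpr ((Ideal.height_comap_le_of_flat hφ z'.asIdeal).trans
    (Ideal.height_le_height_comap_of_isIntegral ?_ z'.asIdeal))
  have h : (Algebra.TensorProduct.includeLeftRingHom (R := R) (A := W) (B := R')).IsIntegral :=
    (inferInstance : Algebra.IsIntegral W (W ⊗[R] R')).1
  have := RingHom.IsIntegral.trans _ _ h (RingHom.isIntegral_of_surjective
    (Algebra.TensorProduct.comm R W R').toRingEquiv.toRingHom
      (Algebra.TensorProduct.comm R W R').surjective)
  convert! this using 1

end Affine

end WeilPoint

namespace AlgebraicGeometry.IsAffineOpen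

variable {X Y : Scheme.{u}} (f : X ⟶ Y)

lemma isPullback_fromSpec [IsAffineHom f] {A : Y.Opens} (hA : IsAffineOpen A) :
    IsPullback (Spec.map (f.app A)) (hA.preimage f).fromSpec hA.fromSpec f := by
  refine (isPullback_morphismRestrict f A).of_iso (hA.preimage f).isoSpec hA.isoSpec
    (Iso.refl _) (Iso.refl _) ?_ (by simp) (by simp) (by simp)
  rw [← cancel_mono hA.fromSpec, Category.assoc, Category.assoc, hA.isoSpec_hom_fromSpec,
    ← Scheme.Hom.appLE_eq_app, hA.SpecMap_appLE_fromSpec f (hA.preimage f) le_rfl,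
    IsAffineOpen.isoSpec_hom_fromSpec_assoc, morphismRestrict_ι]

end AlgebraicGeometry.IsAffineOpen

namespace WeilPoint

variable {S S' X : Scheme.{u}} {p : S' ⟶ S} {f : X ⟶ S'}

theorem exists_isChart [IsLocallyNoetherian S] [IsFinite p] [Flat p] [Smooth f] {A : S.Opens}
    (hA : IsAffineOpen A) {V : X.Opens} (hV : IsAffineOpen V) (hVA : V ≤ f ⁻¹ᵁ p ⁻¹ᵁ A) :
    ∃ (W : Scheme.{u}) (u : WeilPoint p f W), u.IsChart A V ∧
      ∀ z, ringKrullDim (X.presheaf.stalk (u.map z)) ≤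
        ringKrullDim (W.presheaf.stalk (pullback.fst u.base p z)) := by
  have hA' : IsAffineOpen (p ⁻¹ᵁ A) := hA.preimage p
  let : Algebra Γ(S, A) Γ(S', p ⁻¹ᵁ A) := (p.app A).hom.toAlgebra
  let : Algebra Γ(S', p ⁻¹ᵁ A) Γ(X, V) := (f.appLE _ V hVA).hom.toAlgebra
  have hfin : Module.Finite Γ(S, A) Γ(S', p ⁻¹ᵁ A) := p.finite_app A hA
  have : IsNoetherianRing Γ(S, A) := IsLocallyNoetherian.component_noetherian ⟨A, hA⟩
  -- Finite presentation together with flatness gives projectivity, hence a dual basis.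
  have : Module.FinitePresentation Γ(S, A) Γ(S', p ⁻¹ᵁ A) :=
    Module.finitePresentation_of_finite _ _
  have : Module.Flat Γ(S, A) Γ(S', p ⁻¹ᵁ A) := by
    have := p.flat_appLE hA hA' le_rfl
    rwa [Scheme.Hom.appLE_eq_app] at this
  have : Module.Projective Γ(S, A) Γ(S', p ⁻¹ᵁ A) := Module.Flat.projective_of_finitePresentation
  have : Algebra.Smooth Γ(S', p ⁻¹ᵁ A) Γ(X, V) := f.smooth_appLE hA' hV hVA
  obtain ⟨W, _, _, φ, hφ⟩ := WeilRestriction.exists_isUniversal Γ(S, A) Γ(S', p ⁻¹ᵁ A) Γ(X, V)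
  have hp := hA.isPullback_fromSpec p
  have hf := (hA'.SpecMap_appLE_fromSpec f hV hVA).symm
  refine ⟨Spec (.of W), ofAlgHom (k := hV.fromSpec) hp hf φ, ?_,
    ringKrullDim_stalk_ofAlgHom_le (k := hV.fromSpec) hp hf hφ.flat⟩
  have := ofAlgHom_isChart (k := hV.fromSpec) hp hf hφ
  rwa [hA.opensRange_fromSpec, hV.opensRange_fromSpec] at this

end WeilPoint

/-! ### Finite sets of points in affine opens, and covering by charts. -/

/-- A weak form of quasi-projectivity: over every affine open, the morphism admits an immersion
into a projective space. -/
def AlgebraicGeometry.LocallyImmersesInProjSpace {X Y : Scheme.{u}} (f : X ⟶ Y) : Prop :=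
  ∀ (R : CommRingCat.{u}) (i : Spec R ⟶ Y), IsOpenImmersion i →
    ∃ (n : ℕ) (j : pullback f i ⟶ projSpace n R), IsImmersion j

namespace AlgebraicGeometry.LocallyImmersesInProjSpace

variable {X Y U : Scheme.{u}} {f : X ⟶ Y}

lemma _root_.IsQuasiProjective.locallyImmersesInProjSpace (hf : IsQuasiProjective f) :
    LocallyImmersesInProjSpace f := fun R i hi ↦
  let ⟨n, j, hj, _⟩ := hf.exists_immersion R i hi
  ⟨n, j, hj⟩

/-- This lets the existence theorem apply to `U` as well as to `X`; the weak form carries no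
quasi-compactness condition to check. -/
lemma comp_left (hf : LocallyImmersesInProjSpace f) (a : U ⟶ X) [IsOpenImmersion a] :
    LocallyImmersesInProjSpace (a ≫ f) := fun R i hi ↦ by
  obtain ⟨n, j, hj⟩ := hf R i hi
  let e : pullback (a ≫ f) i ⟶ pullback f i :=
    pullback.lift (pullback.fst _ _ ≫ a) (pullback.snd _ _) (by simp [pullback.condition])
  have he : IsPullback e (pullback.fst _ _) (pullback.fst _ _) a := by
    refine .of_right (h₁₂ := pullback.snd f i) (h₂₂ := f) (v₁₃ := i) ?_ (pullback.lift_fst _ _ _)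
      (IsPullback.of_hasPullback _ _).flip
    rw [pullback.lift_snd]
    exact (IsPullback.of_hasPullback _ _).flip
  have : IsOpenImmersion e := MorphismProperty.of_isPullback he.flip inferInstance
  exact ⟨n, e ≫ j, inferInstance⟩

lemma exists_isAffineOpen (hf : LocallyImmersesInProjSpace f) {A : Y.Opens} (hA : IsAffineOpen A)
    {Z : Set X} (hZ : Z.Finite) (hZA : ∀ z ∈ Z, f z ∈ A) :
    ∃ V : X.Opens, IsAffineOpen V ∧ Z ⊆ V ∧ V ≤ f ⁻¹ᵁ A := by
  obtain ⟨n, j, hj⟩ := hf _ hA.fromSpec inferInstance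
  let g := pullback.fst f hA.fromSpec
  have hg : Set.range g = f ⁻¹' A := by
    rw [IsOpenImmersion.range_pullbackFst, hA.opensRange_fromSpec]
    rfl
  obtain ⟨V, hV, hZV⟩ := exists_isAffineOpen_of_isImmersion_projSpace j (g ⁻¹' Z)
    (hZ.preimage g.isOpenEmbedding.injective.injOn)
  refine ⟨g ''ᵁ V, hV.image_of_isOpenImmersion g, fun z hz ↦ ?_, ?_⟩
  · obtain ⟨z, rfl⟩ : z ∈ Set.range g := hg ▸ hZA z hz
    exact ⟨z, hZV hz, rfl⟩
  · rintro _ ⟨z, -, rfl⟩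
    exact (hg ▸ ⟨z, rfl⟩ : g z ∈ f ⁻¹' A)

end AlgebraicGeometry.LocallyImmersesInProjSpace

namespace WeilPoint

variable {S S' X T T' : Scheme.{u}} {p : S' ⟶ S} {f : X ⟶ S'}

/-- The fibre of `T ×_S S'` over `τ` is finite, so all values of `x` above `τ` lie in a single
affine open `V`. Projective embeddings enter the argument only here. -/
theorem exists_mem_chartLocus [IsFinite p] (hf : LocallyImmersesInProjSpace f)
    (x : WeilPoint p f T) (τ : T) :
    ∃ (A : S.Opens) (V : X.Opens), IsAffineOpen A ∧ IsAffineOpen V ∧ V ≤ f ⁻¹ᵁ p ⁻¹ᵁ A ∧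
      τ ∈ x.chartLocus A V := by
  obtain ⟨_, ⟨A, hA, rfl⟩, hτ, -⟩ := S.isBasis_affineOpens.exists_subset_of_mem_open
    (Set.mem_univ (x.base τ)) isOpen_univ
  have hfin : (x.map '' (pullback.fst x.base p ⁻¹' {τ})).Finite :=
    (Scheme.Hom.finite_preimage_singleton _ _).image _
  obtain ⟨V, hV, hZV, hVA⟩ := hf.exists_isAffineOpen (hA.preimage p) hfin (by
    rintro _ ⟨z, hz, rfl⟩
    rw [← Scheme.Hom.comp_apply, x.w, Scheme.Hom.mem_preimage, ← Scheme.Hom.comp_apply,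
      ← pullback.condition, Scheme.Hom.comp_apply]
    rw [show pullback.fst x.base p z = τ from hz]
    exact hτ)
  exact ⟨A, V, hA, hV, hVA, hτ, fun z hz ↦ hZV ⟨z, hz, rfl⟩⟩

end WeilPoint

/-! ### Representability of the Weil restriction. -/

namespace WeilPoint

variable {S S' X T T' W : Scheme.{u}} (p : S' ⟶ S) (f : X ⟶ S')

/-- The presheaf of points of the Weil restriction on the category of all schemes. -/
noncomputable def presheaf : Scheme.{u}ᵒᵖ ⥤ Type u where
  obj T := WeilPoint p f T.unop
  map h := ↾fun x ↦ x.restrict h.unop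
  map_id T := by
    ext x
    exact restrict_id x
  map_comp h h' := by
    ext x
    exact restrict_comp x _ _

lemma isSheaf_presheaf : Presieve.IsSheaf Scheme.zariskiTopology (presheaf p f) := by
  rw [Precoverage.isSheaf_toGrothendieck_iff_of_isStableUnderBaseChange]
  rintro T R hR x hx
  obtain ⟨(𝒰 : T.OpenCover), rfl⟩ := Scheme.exists_cover_of_mem_pretopology hR
  obtain ⟨y, hy⟩ := exists_glue (p := p) (f := f) 𝒰 (fun i ↦ x (𝒰.f i) (.mk i))
    fun i j ↦ hx _ _ _ _ pullback.condition
  refine ⟨y, ?_, fun y' hy' ↦ ext_of_openCover (p := p) (f := f) 𝒰 fun i ↦ ?_⟩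
  · rintro Z e ⟨j⟩
    exact hy j
  · exact (hy' (𝒰.f i) (.mk i)).trans (hy i).symm

variable {p f}

/-- The morphism of presheaves classified by a point of the Weil restriction. -/
noncomputable def toPresheaf (u : WeilPoint p f W) : yoneda.obj W ⟶ presheaf p f :=
  yonedaEquiv.symm (show (presheaf p f).obj (op W) from u)

/-- A morphism to `T` factors through the chart locus exactly when the restricted point lies in the
chart. Hence the chart is an open subfunctor. -/
lemma isPullback_toPresheaf [IsFinite p] {u : WeilPoint p f W} {A : S.Opens} {V : X.Opens}
    (hu : u.IsChart A V) (x : WeilPoint p f T) (g : (x.chartLocus A V).toScheme ⟶ W)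
    (hg : u.restrict g = x.restrict (x.chartLocus A V).ι) :
    IsPullback (yoneda.map g) (yoneda.map (x.chartLocus A V).ι) u.toPresheaf x.toPresheaf := by
  refine .of_forall_isPullback_app fun T' ↦ ?_
  rw [Types.isPullback_iff]
  refine ⟨?_, fun a b hab ↦ ?_, fun h t ht ↦ ?_⟩
  · ext t
    change u.restrict (t ≫ g) = x.restrict (t ≫ _)
    rw [restrict_comp, hg, ← restrict_comp]
  · exact (cancel_mono (x.chartLocus A V).ι).mp hab.2
  · change T'.unop ⟶ W at h
    change T'.unop ⟶ T at t
    change u.restrict h = x.restrict t at ht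
    have hmem : ∀ τ, t τ ∈ x.chartLocus A V :=
      (inChart_restrict_iff t).mp (ht ▸ hu.inChart.restrict h)
    have hr : Set.range t ⊆ Set.range (x.chartLocus A V).ι := by
      rw [Scheme.Opens.range_ι]
      rintro _ ⟨τ, rfl⟩
      exact hmem τ
    let l := IsOpenImmersion.lift (x.chartLocus A V).ι t hr
    have hl : l ≫ _ = t := IsOpenImmersion.lift_fac _ _ _
    refine ⟨l, hu.hom_ext ?_, hl⟩
    change u.restrict (l ≫ g) = u.restrict h
    rw [restrict_comp, hg, ← restrict_comp, hl, ht]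

lemma presheaf_toPresheaf [IsFinite p] {u : WeilPoint p f W} {A : S.Opens} {V : X.Opens}
    (hu : u.IsChart A V) : IsOpenImmersion.presheaf u.toPresheaf := by
  refine MorphismProperty.relative.of_exists fun T y ↦ ?_
  obtain ⟨x, rfl⟩ : ∃ x : WeilPoint p f T, y = x.toPresheaf :=
    ⟨yonedaEquiv y, (yonedaEquiv.symm_apply_apply y).symm⟩
  obtain ⟨g, hg⟩ := hu.exists_of_chartLocus x
  exact ⟨_, _, _, isPullback_toPresheaf hu x g hg, inferInstance⟩

/-- The Weil restriction is representable if it is covered by charts. -/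
theorem exists_isUniversal_of_charts [IsFinite p] {ι : Type u} {W : ι → Scheme.{u}}
    (u : ∀ i, WeilPoint p f (W i)) (A : ι → S.Opens) (V : ι → X.Opens)
    (hu : ∀ i, (u i).IsChart (A i) (V i))
    (hcov : ∀ ⦃T : Scheme.{u}⦄ (x : WeilPoint p f T) (τ : T), ∃ i, τ ∈ x.chartLocus (A i) (V i)) :
    ∃ (Y : Scheme.{u}) (x : WeilPoint p f Y), x.IsUniversal := by
  let F : Sheaf Scheme.zariskiTopology.{u} (Type u) :=
    ⟨presheaf p f, (isSheaf_iff_isSheaf_of_type _ _).mpr (isSheaf_presheaf p f)⟩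
  let c (i : ι) : yoneda.obj (W i) ⟶ F.1 := (u i).toPresheaf
  -- A `T`-point comes from a chart on each of its chart loci, and these cover `T`.
  have hsurj : Presheaf.IsLocallySurjective Scheme.zariskiTopology (Sigma.desc c) := by
    refine ⟨fun {T} (x : WeilPoint p f T) ↦ ?_⟩
    let 𝒰 : T.OpenCover := T.openCoverOfIsOpenCover (fun i ↦ x.chartLocus (A i) (V i))
      (.mk (by ext τ; simpa using hcov x τ))
    refine GrothendieckTopology.superset_covering _ ?_ 𝒰.mem_grothendieckTopology
    rw [Sieve.ofArrows, Sieve.generate_le_iff]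
    rintro _ _ ⟨i⟩
    obtain ⟨g, hg⟩ := (hu i).exists_of_chartLocus x
    exact ⟨(Sigma.ι (fun i ↦ yoneda.obj (W i)) i).app _ g,
      (congr_arg (fun m ↦ m.app _ g) (Sigma.ι_desc c i)).trans hg⟩
  obtain ⟨Y, ⟨hY⟩⟩ := Scheme.LocalRepresentability.isRepresentable (F := F) (f := c)
    fun i ↦ presheaf_toPresheaf (hu i)
  have hY' {T : Scheme.{u}} (h : T ⟶ Y) :
      WeilPoint.restrict (hY.homEquiv (𝟙 Y)) h = hY.homEquiv h :=
    (hY.homEquiv_eq h).symm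
  refine ⟨Y, hY.homEquiv (𝟙 Y), fun T y ↦ ⟨hY.homEquiv.symm y, ?_, fun h hh ↦ ?_⟩⟩
  · exact (hY' _).trans (hY.homEquiv.apply_symm_apply y)
  · exact (hY.homEquiv.symm_apply_eq.mpr (hh.symm.trans (hY' h))).symm

theorem exists_isUniversal [IsLocallyNoetherian S] [IsFinite p] [Flat p] [Smooth f]
    (hf : LocallyImmersesInProjSpace f) :
    ∃ (Y : Scheme.{u}) (x : WeilPoint p f Y), x.IsUniversal := by
  let ι : Type u := {a : S.Opens × X.Opens //
    IsAffineOpen a.1 ∧ IsAffineOpen a.2 ∧ a.2 ≤ f ⁻¹ᵁ p ⁻¹ᵁ a.1}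
  choose W u hu _ using fun i : ι ↦ exists_isChart (p := p) (f := f) i.2.1 i.2.2.1 i.2.2.2
  refine exists_isUniversal_of_charts u _ _ hu fun T x τ ↦ ?_
  obtain ⟨A, V, hA, hV, hVA, hτ⟩ := x.exists_mem_chartLocus hf τ
  exact ⟨⟨(A, V), hA, hV, hVA⟩, hτ⟩

end WeilPoint

/-! ### Comparison with `weilRestriction`, and birationality. -/

namespace WeilPoint

variable {S S' X U : Scheme.{u}} {p : S' ⟶ S} {f : X ⟶ S'}

/-- The point of the Weil restriction given by a section of `weilRestriction`. -/
noncomputable def ofSection {T : Over S} (e : (Over.pullback p).obj T ⟶ Over.mk f) :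
    WeilPoint p f T.left where
  base := T.hom
  map := e.left
  w := Over.w e

lemma ofSection_injective {T : Over S} {e e' : (Over.pullback p).obj T ⟶ Over.mk f}
    (h : ofSection e = ofSection e') : e = e' := by
  apply Over.OverMorphism.ext
  simpa [ofSection] using h

lemma ofSection_map {T T' : Over S} (k : T' ⟶ T) (e : (Over.pullback p).obj T ⟶ Over.mk f) :
    ofSection ((Over.pullback p).map k ≫ e) = (ofSection e).restrict k.left := by
  refine ext_of_eval (Over.w k).symm (.of_hasPullback _ _) ?_
  refine (map_eq_eval _).symm.trans (Eq.trans ?_ (restrict_eval _ _ _ _ _).symm)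
  rfl

/-- A point carries its own base morphism, so representability over `S` becomes a universal property
among all schemes. -/
lemma isUniversal_of_representableBy {R : Over S}
    (h : (weilRestriction p (Over.mk f)).RepresentableBy R) :
    (ofSection (h.homEquiv (𝟙 R))).IsUniversal := by
  have key {T : Over S} (k : T ⟶ R) :
      (ofSection (h.homEquiv (𝟙 R))).restrict k.left = ofSection (h.homEquiv k) :=
    (ofSection_map k _).symm.trans (congr_arg ofSection (h.homEquiv_eq k).symm)
  intro T y
  let e : (Over.pullback p).obj (Over.mk y.base) ⟶ Over.mk f := Over.homMk y.map y.w
  refine ⟨(h.homEquiv.symm e).left,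
    (key _).trans (congr_arg ofSection (h.homEquiv.apply_symm_apply e)), fun g hg ↦ ?_⟩
  let g' : Over.mk y.base ⟶ R := Over.homMk g (congr_arg base hg)
  have : h.homEquiv g' = e := ofSection_injective ((key g').symm.trans hg)
  rw [← this, Equiv.symm_apply_apply]
  rfl

lemma IsUniversal.isRepresentable {Y : Scheme.{u}} {x : WeilPoint p f Y} (hx : x.IsUniversal) :
    (weilRestriction p (Over.mk f)).IsRepresentable := by
  let e : (Over.pullback p).obj (Over.mk x.base) ⟶ Over.mk f := Over.homMk x.map x.w
  refine ⟨Over.mk x.base, ⟨⟨fun {T} ↦ Equiv.ofBijective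
    (fun k ↦ ((Over.pullback p).map k ≫ e : (Over.pullback p).obj T ⟶ Over.mk f))
      ⟨fun k k' hk ↦ ?_, fun y ↦ ?_⟩, fun k k' ↦ ?_⟩⟩⟩
  · apply Over.OverMorphism.ext
    exact hx.hom_ext ((ofSection_map k e).symm.trans
      ((congr_arg ofSection hk).trans (ofSection_map k' e)))
  · obtain ⟨g, hg, -⟩ := hx (ofSection y)
    refine ⟨Over.homMk g (congr_arg base hg), ofSection_injective ?_⟩
    exact (ofSection_map _ e).trans hg
  · change (Over.pullback p).map (k ≫ k') ≫ e = (Over.pullback p).map k ≫ _ ≫ e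
    rw [Functor.map_comp, Category.assoc]

lemma restrict_weilRestrictionHom {α : U ⟶ X} {RU RX : Over S}
    (hU : (weilRestriction p (Over.mk (α ≫ f))).RepresentableBy RU)
    (hX : (weilRestriction p (Over.mk f)).RepresentableBy RX) :
    (ofSection (hX.homEquiv (𝟙 RX))).restrict
        (weilRestrictionHom (Over.homMk α : Over.mk (α ≫ f) ⟶ Over.mk f) hU hX).left =
      (ofSection (hU.homEquiv (𝟙 RU))).mapTarget α := by
  refine (ofSection_map _ _).symm.trans (congr_arg ofSection
    ((hX.homEquiv_eq _).symm.trans (hX.homEquiv.apply_symm_apply _)))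

/-- The image of `h` is the locus where all values of `x` lie in the image of `α`. Codimension can
be computed in an affine chart around `y`, where every value above `y` has codimension at most that
of `y`. -/
theorem IsUniversal.isDBirational [IsLocallyNoetherian S] [IsFinite p] [Flat p] [Smooth f]
    (hf : LocallyImmersesInProjSpace f) {d : ℤ} {α : U ⟶ X} (hα : IsDBirational d α)
    {Y Y' : Scheme.{u}} {x : WeilPoint p f Y} (hx : x.IsUniversal)
    {x' : WeilPoint p (α ≫ f) Y'} (hx' : x'.IsUniversal) {h : Y' ⟶ Y}
    (hh : x.restrict h = x'.mapTarget α) : IsDBirational d h := by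
  have := hα.isOpenImmersion
  obtain ⟨ho, hr⟩ := hx.isOpenImmersion_of_isChart hx'.isChart_mapTarget h hh
  refine ⟨ho, fun y n hn hnd ↦ ?_⟩
  rw [hr]
  obtain ⟨A, V, hA, hV, hVA, hy⟩ := x.exists_mem_chartLocus hf y
  obtain ⟨W, u, hu, hdim⟩ := exists_isChart hA hV hVA
  obtain ⟨g, hg, -⟩ := hx u
  obtain ⟨hgo, hgr⟩ := hx.isOpenImmersion_of_isChart hu g hg
  obtain ⟨w, rfl⟩ : y ∈ Set.range g := hgr ▸ hy
  rw [ringKrullDim_stalk_of_isOpenImmersion] at hn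
  refine (mem_chartLocus_restrict g w).mp ?_
  rw [show x.restrict g = u from hg]
  refine ⟨trivial, fun z hz ↦ ?_⟩
  have hle : ringKrullDim (X.presheaf.stalk (u.map z)) ≤ n := by
    rw [← hn, ← hz]
    exact hdim z
  -- `IsDBirational` speaks of natural dimensions: the value `⊥` is excluded because stalks are
  -- nontrivial, and `⊤` by the bound `n`.
  obtain ⟨m, hm⟩ : ∃ m : ℕ, ringKrullDim (X.presheaf.stalk (u.map z)) = m := by
    obtain ⟨e, he⟩ := WithBot.ne_bot_iff_exists.mp ((WithBot.bot_lt_coe 0).trans_le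
      (ringKrullDim_nonneg_of_nontrivial (R := X.presheaf.stalk (u.map z)))).ne'
    rw [← he] at hle ⊢
    obtain ⟨m, rfl⟩ := ENat.ne_top_iff_exists.mp
      (ne_top_of_le_ne_top (ENat.natCast_ne_top n) (WithBot.coe_le_coe.mp hle))
    exact ⟨m, rfl⟩
  rw [hm] at hle
  have : m ≤ n := by exact_mod_cast hle
  exact hα.mem_range _ m hm (by lia)

end WeilPoint

theorem proposition2p8 {S S' X U : Scheme.{u}} [IsLocallyNoetherian S]
    (p : S' ⟶ S) [IsFinite p] [Flat p] [LocallyOfFinitePresentation p]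
    (f : X ⟶ S') [Smooth f] (hf : IsQuasiProjective f)
    (d : ℤ) (α : U ⟶ X) (hα : IsDBirational d α) :
    (weilRestriction p (Over.mk (α ≫ f))).IsRepresentable ∧
    (weilRestriction p (Over.mk f)).IsRepresentable ∧
    ∀ (RU RX : Over S)
      (hU : (weilRestriction p (Over.mk (α ≫ f))).RepresentableBy RU)
      (hX : (weilRestriction p (Over.mk f)).RepresentableBy RX),
      IsDBirational d
        (weilRestrictionHom (Over.homMk α : Over.mk (α ≫ f) ⟶ Over.mk f) hU hX).left := by
  have := hα.isOpenImmersion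
  have hf' := hf.locallyImmersesInProjSpace
  obtain ⟨_, _, hx⟩ := WeilPoint.exists_isUniversal (p := p) (hf'.comp_left α)
  obtain ⟨_, _, hx'⟩ := WeilPoint.exists_isUniversal (p := p) hf'
  exact ⟨hx.isRepresentable, hx'.isRepresentable, fun RU RX hU hX ↦
    (WeilPoint.isUniversal_of_representableBy hX).isDBirational hf' hα
      (WeilPoint.isUniversal_of_representableBy hU) (WeilPoint.restrict_weilRestrictionHom hU hX)⟩
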